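/- **Setting.** An agent has a private type $\theta\in\Theta=[\underline\theta,\bar\theta]$, $0\le\underline\theta<\bar\theta$, with distribution function $F$ and continuous density $f>0$ on $\Theta$. He chooses a quality $q\in Q=[0,q_{\max}]$, $q_{\max}>0$, at cost $c(q)/\theta$, where $c$ is twice continuously differentiable on $Q$, $c(0)=0$, $c'(q)>0$ for $q>0$ and $c''\ge 0$. The principal's payoff $v(q,\theta)$ is twice continuously differentiable on $Q\times\Theta$ with $v_{qq}\le 0$. The market values the type $\theta$. Payoffs of type $\theta$ are multiplied by $\theta$, so that at interim wage $w$ he gets $\theta w-c(q)$. "Increasing" means weakly increasing. **Direct mechanisms.** Let $w_0\in[0,\underline\theta]$ be the wage of an agent who does not take the test. The principal chooses $q:\Theta\to Q$ and an integrable interim wage $w:\Theta\to\mathbb R_+$ to maximize $\int_\Theta v(q(\theta),\theta)\,dF(\theta)$ subject to, for all $\theta\in\Theta$: $q$ is increasing; $\theta w(\theta)-c(q(\theta))=\int_{\underline\theta}^{\theta}w(x)\,dx+\underline U$ for some constant $\underline U$; $\theta w(\theta)-c(q(\theta))\ge w_0\theta$; $\int_{\underline\theta}^{\theta}w\,dF\ge\int_{\underline\theta}^{\theta}x\,dF(x)$;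 and $\int_{\Theta}w\,dF=\int_{\Theta}x\,dF(x)$. **Ratings.** A (possibly stochastic) rating is a Markov kernel $\pi$ from $Q$ to a measurable space $S$ of scores. A quality scheme $q:\Theta\to Q$ and measurable wages $\omega:S\to\Theta$ form an equilibrium under $\pi$ if $\omega(s)=\mathbb E[\theta\mid s]$ almost surely for $\theta\sim F$, $s\sim\pi(q(\theta))$, and, with $\hat w(q)=\mathbb E_{s\sim\pi(q)}[\omega(s)]$, for every $\theta\in\Theta$ the quality $q(\theta)$ maximizes $\theta\hat w(q')-c(q')$ over $q'\in Q$ and $\theta\hat w(q(\theta))-c(q(\theta))\ge\underline\theta\,\theta$. **Full separation.** Let $q_f:\Theta\to[0,q_{\max})$ be continuous on $\Theta$ and differentiable in its interior, with $c'(q_f(\theta))\,q_f'(\theta)=\theta$ there and $\underline\theta^2-c(q_f(\underline\theta))=w_0\underline\theta$. This is the quality scheme that goes with the interim wage $w(\theta)=\theta$. Assume $v_q(q_f(\theta),\theta)\ge 0$ for all $\theta\in\Theta$, and put $$J(\theta\mid q_f)=\frac{v_q(q_f(\theta),\theta)\,\theta}{c'(q_f(\theta))}-\frac{1}{f(\theta)}\int_\theta^{\bar\theta}\frac{v_q(q_f(x),x)}{c'(q_f(x))}\,dF(x).$$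 **Proposition.** 1. The direct mechanism $q=q_f$, $w(\theta)=\theta$ is optimal in the principal's problem over direct mechanisms if and only if $J(\theta\mid q_f)$ is increasing in $\theta$ on $(\underline\theta,\bar\theta]$. 2. If $w_0=\underline\theta$, then full separation is optimal among all ratings if and only if $J(\theta\mid q_f)$ is increasing in $\theta$ on $(\underline\theta,\bar\theta]$. Here full separation is optimal among all ratings if some rating has an equilibrium with quality scheme $q_f$ and $\hat w(q_f(\theta))=\theta$ for all $\theta\in\Theta$, and no equilibrium under any rating gives the principal a larger expected payoff. 3. If $v(q,\theta)=q$ and $c(q)=q$, then $J(\theta\mid q_f)=\theta-\frac{1-F(\theta)}{f(\theta)}$ on $\Theta$, and the optimality in 1 (and, if $w_0=\underline\theta$, that in 2) holds if and only if $\theta-\frac{1-F(\theta)}{f(\theta)}$ is increasing on $\Theta$ (Myerson regularity). -/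

import Mathlib

open MeasureTheory ProbabilityTheory Set

noncomputable section

/-- The ability-signaling environment with multiplicatively separable cost.  Types `θ` lie in
`[a, b]` with `0 ≤ a < b` and have a continuous positive density `f`; qualities lie in
`Q = [0, qmax]`; the cost of quality `q` to type `θ` is `c q / θ`; the principal's payoff is
`v q θ`.  Functions are only ever used on these sets.  The marginal cost at `0` may be zero or
positive, so that both `c q = q ^ 2 / 2` and `c q = q` are covered. -/
structure SignalingModel where
  /-- lowest type -/
  a : ℝ
  /-- highest type -/
  b : ℝ
  /-- highest quality -/
  qmax : ℝ
  /-- density of the type distribution -/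
  f : ℝ → ℝ
  /-- cost function -/
  c : ℝ → ℝ
  /-- payoff of the principal -/
  v : ℝ → ℝ → ℝ
  a_nonneg : 0 ≤ a
  a_lt_b : a < b
  qmax_pos : 0 < qmax
  f_cont : ContinuousOn f (Icc a b)
  f_pos : ∀ θ ∈ Icc a b, 0 < f θ
  f_prob : ∫ θ in a..b, f θ = 1
  c_smooth : ContDiffOn ℝ 2 c (Icc 0 qmax)
  c_zero : c 0 = 0
  c_deriv_pos : ∀ q ∈ Ioc 0 qmax, 0 < derivWithin c (Icc 0 qmax) q
  c_deriv2_nonneg : ∀ q ∈ Icc 0 qmax, 0 ≤ iteratedDerivWithin 2 c (Icc 0 qmax) q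
  v_smooth : ContDiffOn ℝ 2 (Function.uncurry v) (Icc 0 qmax ×ˢ Icc a b)
  v_deriv2_nonpos : ∀ θ ∈ Icc a b, ∀ q ∈ Icc 0 qmax,
    iteratedDerivWithin 2 (fun x => v x θ) (Icc 0 qmax) q ≤ 0

namespace SignalingModel

variable (M : SignalingModel)

/-- The marginal cost `c'(q)` (one-sided at the end points of `Q`). -/
def c' (q : ℝ) : ℝ := derivWithin M.c (Icc 0 M.qmax) q

/-- The marginal payoff `v_q(q, θ)` (one-sided at the end points of `Q`). -/
def vq (q θ : ℝ) : ℝ := derivWithin (fun x => M.v x θ) (Icc 0 M.qmax) q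

/-- The distribution function `F` of the type. -/
def F (θ : ℝ) : ℝ := ∫ x in M.a..θ, M.f x

/-- The principal's expected payoff from the quality scheme `q`. -/
def payoff (q : ℝ → ℝ) : ℝ := ∫ θ in M.a..M.b, M.v (q θ) θ * M.f θ

/-! ### The principal's problem over direct mechanisms -/

/-- `(q, w)` satisfies the constraints of the principal's problem, where an agent who does not
take the test is paid `w0`. Type `θ`'s payoff is multiplied by `θ` throughout. -/
structure Admissible (w0 : ℝ) (q w : ℝ → ℝ) : Prop where
  quality_mem : ∀ θ ∈ Icc M.a M.b, q θ ∈ Icc 0 M.qmax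
  wage_nonneg : ∀ θ ∈ Icc M.a M.b, 0 ≤ w θ
  wage_integrable : IntervalIntegrable w volume M.a M.b
  /-- (IC-Mon) -/
  ic_mon : MonotoneOn q (Icc M.a M.b)
  /-- (IC-Env) -/
  ic_env : ∃ U : ℝ, ∀ θ ∈ Icc M.a M.b, θ * w θ - M.c (q θ) = (∫ x in M.a..θ, w x) + U
  /-- (IR) -/
  ir : ∀ θ ∈ Icc M.a M.b, w0 * θ ≤ θ * w θ - M.c (q θ)
  /-- (MPS) -/
  mps : ∀ θ ∈ Icc M.a M.b, ∫ x in M.a..θ, x * M.f x ≤ ∫ x in M.a..θ, w x * M.f x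
  /-- (BP) -/
  bp : ∫ x in M.a..M.b, w x * M.f x = ∫ x in M.a..M.b, x * M.f x

/-- `q` with the interim wage `w` solves the principal's problem. -/
def IsOptimalMechanism (w0 : ℝ) (q w : ℝ → ℝ) : Prop :=
  M.Admissible w0 q w ∧ ∀ q' w' : ℝ → ℝ, M.Admissible w0 q' w' → M.payoff q' ≤ M.payoff q

/-! ### Ratings -/

/-- The interim wage `ŵ(q) = 𝔼_{s ∼ π(q)} [ω(s)]` induced by the rating `π` and the market's
wages `ω`. -/
def interimWage {S : Type} [MeasurableSpace S] (π : Kernel ℝ S) (ω : S → ℝ) (q : ℝ) : ℝ :=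
  ∫ s, ω s ∂(π q)

/-- Given the (possibly stochastic) rating `π`, a Blackwell experiment from qualities to scores
(only its values on `Q` matter), the quality scheme `q` and the wages `ω` form an equilibrium:
the wage after a score is the posterior mean of the type, by Bayes' rule on the equilibrium path
and for some belief on `[a, b]` off it, and every type chooses an optimal quality. Every agent
takes the test; not taking it is paid `a`. -/
structure IsEquilibrium {S : Type} [MeasurableSpace S] (π : Kernel ℝ S) (ω : S → ℝ)
    (q : ℝ → ℝ) : Prop where
  wage_measurable : Measurable ω
  wage_mem : ∀ s, ω s ∈ Icc M.a M.b
  quality_mem : ∀ θ ∈ Icc M.a M.b, q θ ∈ Icc 0 M.qmax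
  /-- `ω(s) = 𝔼[θ | s]` almost surely, for `θ` with density `f` and `s ∼ π(q(θ))` -/
  bayes : ∀ A : Set S, MeasurableSet A →
    ∫ θ in M.a..M.b, (∫ s in A, ω s ∂(π (q θ))) * M.f θ =
      ∫ θ in M.a..M.b, θ * (π (q θ)).real A * M.f θ
  incentive : ∀ θ ∈ Icc M.a M.b, ∀ q' ∈ Icc 0 M.qmax,
    θ * interimWage π ω q' - M.c q' ≤ θ * interimWage π ω (q θ) - M.c (q θ)
  participation : ∀ θ ∈ Icc M.a M.b,
    M.a * θ ≤ θ * interimWage π ω (q θ) - M.c (q θ)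

/-- Some rating implements the quality scheme `q` with interim wage `w` on `[a, b]`, and no
equilibrium under any rating gives the principal more. -/
def IsOptimalUnderRatings (q w : ℝ → ℝ) : Prop :=
  (∃ (S : Type) (_ : MeasurableSpace S) (π : Kernel ℝ S) (ω : S → ℝ),
    IsMarkovKernel π ∧ M.IsEquilibrium π ω q ∧
      ∀ θ ∈ Icc M.a M.b, interimWage π ω (q θ) = w θ) ∧
  ∀ (S : Type) (_ : MeasurableSpace S) (π : Kernel ℝ S) (ω : S → ℝ) (q' : ℝ → ℝ),
    IsMarkovKernel π → M.IsEquilibrium π ω q' → M.payoff q' ≤ M.payoff q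

/-! ### Full separation -/

/-- `qf` is the quality scheme under full separation `w(θ) = θ` when not taking the test is paid
`w0`: it solves `c'(qf(θ)) qf'(θ) = θ`, and the lowest type is indifferent to not taking the
test, `a * a - c(qf(a)) = w0 * a`. The bound `qmax` on quality does not bind. -/
structure IsFullSeparationQuality (w0 : ℝ) (qf : ℝ → ℝ) : Prop where
  mem : ∀ θ ∈ Icc M.a M.b, qf θ ∈ Ico 0 M.qmax
  cont : ContinuousOn qf (Icc M.a M.b)
  diff : ∀ θ ∈ Ioo M.a M.b, DifferentiableAt ℝ qf θ
  foc : ∀ θ ∈ Ioo M.a M.b, M.c' (qf θ) * deriv qf θ = θ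
  ir_binds : M.a * M.a - M.c (qf M.a) = w0 * M.a

/-- `J(θ | qf)`. -/
def J (qf : ℝ → ℝ) (θ : ℝ) : ℝ :=
  M.vq (qf θ) θ * θ / M.c' (qf θ)
    - (∫ x in θ..M.b, M.vq (qf x) x / M.c' (qf x) * M.f x) / M.f θ

/-- Myerson's virtual value `θ - (1 - F(θ)) / f(θ)`. -/
def virtualValue (θ : ℝ) : ℝ := θ - (1 - M.F θ) / M.f θ

end SignalingModel

end

noncomputable section

/-! ### Convexity from the second one-sided derivative -/

/-! Sufficiency comes from linearizing around full separation. For an admissible `(q, w)` put D(θ) =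
w(θ) − θ. Concavity of v, convexity of c and v_q ≥ 0 along `qf` give v(q) − v(qf) ≤ (v_q / c')(c(q)
− c(qf)). The envelope condition and participation of the lowest type bound c(q) − c(qf) by θ D(θ) −
∫_a^θ D (`Admissible.cost_le`). Integrated against f, with the order of integration exchanged, the
bound becomes ∫ J D dF (`integral_weight_mul`). By (MPS) and (BP), D dF has zero total mass and
nonpositive upper tails, so an increasing J makes this nonpositive
(`integral_mul_le_of_monotoneOn`).

The difficulty is at the lowest type, where c'(qf(a)) may vanish and v_q f / c' need not be
integrable. The estimate is therefore made on [s, b] with s > a. With G(s) the integral of v_q f /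
c' over [s, b], the boundary terms combine into (G(s)/f(s)) ∫_a^s D (f − f(s)) plus a nonpositive
term. Here s G(s) is bounded because θ / c'(qf) = qf', ∫_a^s |D| is at most a constant times s, and
f is continuous at a. So the remainder vanishes as s tends to a (`Admissible.payoff_le`).

Necessity: if J(z₁) > J(z₂) for some z₁ < z₂, give types near z₁ and z₂ a small probability of a
common score whose posterior mean m lies between them. Wages rise near z₁ and fall near z₂, and the
first-order change of the payoff is ∫ J D dF > 0 (`exists_pooling`, `eventually_payoff_lt`).

Ratings: every equilibrium induces an admissible direct mechanism with w0 = a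
(`IsEquilibrium.admissible`), so the upper bound carries over. Conversely, full separation and the
pooling variation are induced by actual ratings (`exists_rating_of_pooling`), so necessity carries
over too. -/

theorem monotoneOn_derivWithin_of_iteratedDerivWithin_two_nonneg {h : ℝ → ℝ} {m : ℝ} (hm : 0 < m)
    (hs : ContDiffOn ℝ 2 h (Icc 0 m))
    (h2 : ∀ q ∈ Icc 0 m, 0 ≤ iteratedDerivWithin 2 h (Icc 0 m) q) :
    MonotoneOn (derivWithin h (Icc 0 m)) (Icc 0 m) := by
  have hu := uniqueDiffOn_Icc hm
  have hd : DifferentiableOn ℝ (derivWithin h (Icc 0 m)) (Icc 0 m) := by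
    have := hs.differentiableOn_iteratedDerivWithin (m := 1) (by norm_num) hu
    refine this.congr fun x hx => ?_
    rw [iteratedDerivWithin_one]
  refine monotoneOn_of_deriv_nonneg (convex_Icc _ _) hd.continuousOn
    (hd.mono interior_subset) fun x hx => ?_
  have hx' := interior_subset hx
  have h3 := h2 x hx'
  rw [iteratedDerivWithin_succ] at h3
  have h4 : derivWithin (iteratedDerivWithin 1 h (Icc 0 m)) (Icc 0 m) x =
      derivWithin (derivWithin h (Icc 0 m)) (Icc 0 m) x :=
    derivWithin_congr (fun y hy => by rw [iteratedDerivWithin_one])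
      (by rw [iteratedDerivWithin_one])
  rw [h4, derivWithin_of_mem_nhds (mem_interior_iff_mem_nhds.1 hx)] at h3
  exact h3

theorem convexOn_of_iteratedDerivWithin_two_nonneg {h : ℝ → ℝ} {m : ℝ} (hm : 0 < m)
    (hs : ContDiffOn ℝ 2 h (Icc 0 m))
    (h2 : ∀ q ∈ Icc 0 m, 0 ≤ iteratedDerivWithin 2 h (Icc 0 m) q) :
    ConvexOn ℝ (Icc 0 m) h := by
  have hd := hs.differentiableOn (by norm_num)
  refine MonotoneOn.convexOn_of_deriv (convex_Icc _ _) hd.continuousOn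
    (hd.mono interior_subset) fun x hx y hy hxy => ?_
  have key := monotoneOn_derivWithin_of_iteratedDerivWithin_two_nonneg hm hs h2
    (interior_subset hx) (interior_subset hy) hxy
  rwa [derivWithin_of_mem_nhds (mem_interior_iff_mem_nhds.1 hx),
    derivWithin_of_mem_nhds (mem_interior_iff_mem_nhds.1 hy)] at key

theorem tangent_le_of_iteratedDerivWithin_two_nonneg {h : ℝ → ℝ} {m : ℝ} (hm : 0 < m)
    (hs : ContDiffOn ℝ 2 h (Icc 0 m))
    (h2 : ∀ q ∈ Icc 0 m, 0 ≤ iteratedDerivWithin 2 h (Icc 0 m) q) {x y : ℝ}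
    (hx : x ∈ Icc 0 m) (hy : y ∈ Icc 0 m) :
    h x + derivWithin h (Icc 0 m) x * (y - x) ≤ h y := by
  have hc := convexOn_of_iteratedDerivWithin_two_nonneg hm hs h2
  have hd := hs.differentiableOn (by norm_num) x hx
  rcases lt_trichotomy x y with hxy | rfl | hxy
  · have := hc.derivWithin_le_slope hx hy hxy hd
    rw [slope_def_field, le_div_iff₀ (by linarith)] at this
    linarith
  · simp
  · have := hc.slope_le_derivWithin hy hx hxy hd
    rw [slope_def_field, div_le_iff₀ (by linarith)] at this
    linarith

namespace SignalingModel

variable (M : SignalingModel)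

/-! ### Cost and payoff -/

theorem c_tangent {x y : ℝ} (hx : x ∈ Icc 0 M.qmax) (hy : y ∈ Icc 0 M.qmax) :
    M.c x + M.c' x * (y - x) ≤ M.c y :=
  tangent_le_of_iteratedDerivWithin_two_nonneg M.qmax_pos M.c_smooth M.c_deriv2_nonneg hx hy

theorem c'_mono : MonotoneOn M.c' (Icc 0 M.qmax) :=
  monotoneOn_derivWithin_of_iteratedDerivWithin_two_nonneg M.qmax_pos M.c_smooth M.c_deriv2_nonneg

theorem c'_pos {q : ℝ} (hq : q ∈ Ioc 0 M.qmax) : 0 < M.c' q := M.c_deriv_pos q hq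

theorem c_continuousOn : ContinuousOn M.c (Icc 0 M.qmax) := M.c_smooth.continuousOn

theorem c'_continuousOn : ContinuousOn M.c' (Icc 0 M.qmax) :=
  M.c_smooth.continuousOn_derivWithin (uniqueDiffOn_Icc M.qmax_pos) (by norm_num)

theorem c_strictMonoOn : StrictMonoOn M.c (Icc 0 M.qmax) := by
  refine strictMonoOn_of_deriv_pos (convex_Icc _ _) M.c_continuousOn fun x hx => ?_
  have h := M.c_deriv_pos x (by rw [interior_Icc] at hx; exact ⟨hx.1, hx.2.le⟩)
  rwa [derivWithin_of_mem_nhds (mem_interior_iff_mem_nhds.1 hx)] at h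

theorem c_nonneg {q : ℝ} (hq : q ∈ Icc 0 M.qmax) : 0 ≤ M.c q := by
  rw [← M.c_zero]
  exact M.c_strictMonoOn.monotoneOn ⟨le_rfl, M.qmax_pos.le⟩ hq hq.1

theorem v_section_smooth {θ : ℝ} (hθ : θ ∈ Icc M.a M.b) :
    ContDiffOn ℝ 2 (fun x => M.v x θ) (Icc 0 M.qmax) :=
  M.v_smooth.comp (g := Function.uncurry M.v) (f := fun x : ℝ => (x, θ))
    (contDiff_id.prodMk contDiff_const).contDiffOn fun _ hx => ⟨hx, hθ⟩

theorem v_tangent {x y θ : ℝ} (hθ : θ ∈ Icc M.a M.b) (hx : x ∈ Icc 0 M.qmax)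
    (hy : y ∈ Icc 0 M.qmax) : M.v y θ ≤ M.v x θ + M.vq x θ * (y - x) := by
  have h := tangent_le_of_iteratedDerivWithin_two_nonneg (h := fun x => -M.v x θ) M.qmax_pos
    (M.v_section_smooth hθ).neg (fun q hq => ?_) hx hy
  · have : derivWithin (fun x => -M.v x θ) (Icc 0 M.qmax) x = - M.vq x θ := by
      rw [derivWithin.fun_neg]; rfl
    rw [this] at h
    linarith
  · have h1 := M.v_deriv2_nonpos θ hθ q hq
    have : iteratedDerivWithin 2 (fun x => -M.v x θ) (Icc 0 M.qmax) q =
        - iteratedDerivWithin 2 (fun x => M.v x θ) (Icc 0 M.qmax) q :=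
      iteratedDerivWithin_fun_neg _
    linarith

theorem v_continuousOn : ContinuousOn (Function.uncurry M.v) (Icc 0 M.qmax ×ˢ Icc M.a M.b) :=
  M.v_smooth.continuousOn

theorem vq_continuousOn : ContinuousOn (Function.uncurry M.vq) (Icc 0 M.qmax ×ˢ Icc M.a M.b) := by
  have hu : UniqueDiffOn ℝ (Icc 0 M.qmax ×ˢ Icc M.a M.b) :=
    (uniqueDiffOn_Icc M.qmax_pos).prod (uniqueDiffOn_Icc M.a_lt_b)
  have h1 := M.v_smooth.continuousOn_fderivWithin hu (by norm_num)
  -- The derivative along the slice is the derivative on the rectangle in the direction (1, 0); this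
  -- also covers the boundary of Q.
  have h2 : ContinuousOn (fun p => fderivWithin ℝ (Function.uncurry M.v)
      (Icc 0 M.qmax ×ˢ Icc M.a M.b) p ((1 : ℝ), (0 : ℝ))) (Icc 0 M.qmax ×ˢ Icc M.a M.b) :=
    h1.clm_apply continuousOn_const
  refine h2.congr fun p hp => ?_
  obtain ⟨q, θ⟩ := p
  have hd := (M.v_smooth.differentiableOn (by norm_num) (q, θ) hp).hasFDerivWithinAt
  have hin : HasDerivWithinAt (fun x : ℝ => (x, θ)) ((1 : ℝ), (0 : ℝ)) (Icc 0 M.qmax) q :=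
    (hasDerivWithinAt_id q _).prodMk (hasDerivWithinAt_const q _ θ)
  have hmaps : MapsTo (fun x : ℝ => (x, θ)) (Icc 0 M.qmax) (Icc 0 M.qmax ×ˢ Icc M.a M.b) :=
    fun x hx => ⟨hx, hp.2⟩
  have := hd.comp_hasDerivWithinAt q hin hmaps
  exact this.derivWithin (uniqueDiffOn_Icc M.qmax_pos q hp.1)

theorem exists_vq_bound : ∃ L : ℝ, 0 ≤ L ∧
    ∀ q ∈ Icc 0 M.qmax, ∀ θ ∈ Icc M.a M.b, |M.vq q θ| ≤ L := by
  obtain ⟨L, hL⟩ := (isCompact_Icc.prod isCompact_Icc).exists_bound_of_continuousOn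
    M.vq_continuousOn
  refine ⟨max L 0, le_max_right _ _, fun q hq θ hθ => le_max_of_le_left ?_⟩
  exact hL (q, θ) ⟨hq, hθ⟩

theorem exists_v_bound : ∃ L : ℝ, 0 ≤ L ∧
    ∀ q ∈ Icc 0 M.qmax, ∀ θ ∈ Icc M.a M.b, |M.v q θ| ≤ L := by
  obtain ⟨L, hL⟩ := (isCompact_Icc.prod isCompact_Icc).exists_bound_of_continuousOn
    M.v_continuousOn
  refine ⟨max L 0, le_max_right _ _, fun q hq θ hθ => le_max_of_le_left ?_⟩
  exact hL (q, θ) ⟨hq, hθ⟩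

theorem exists_f_bound : ∃ L : ℝ, 0 ≤ L ∧ ∀ θ ∈ Icc M.a M.b, |M.f θ| ≤ L := by
  obtain ⟨L, hL⟩ := isCompact_Icc.exists_bound_of_continuousOn M.f_cont
  exact ⟨max L 0, le_max_right _ _, fun θ hθ => le_max_of_le_left (hL θ hθ)⟩

theorem exists_f_lower : ∃ l : ℝ, 0 < l ∧ ∀ θ ∈ Icc M.a M.b, l ≤ M.f θ := by
  obtain ⟨x, hx, h⟩ := isCompact_Icc.exists_isMinOn ⟨M.a, left_mem_Icc.2 M.a_lt_b.le⟩ M.f_cont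
  exact ⟨M.f x, M.f_pos x hx, fun θ hθ => h hθ⟩

theorem payoff_integrable {q : ℝ → ℝ} (hq : ∀ θ ∈ Icc M.a M.b, q θ ∈ Icc 0 M.qmax)
    (hm : MonotoneOn q (Icc M.a M.b)) :
    IntervalIntegrable (fun θ => M.v (q θ) θ * M.f θ) volume M.a M.b := by
  obtain ⟨L, hL0, hL⟩ := M.exists_v_bound
  obtain ⟨B, hB0, hB⟩ := M.exists_f_bound
  have hab := M.a_lt_b.le
  rw [intervalIntegrable_iff_integrableOn_Icc_of_le hab]
  -- The scheme `q` is monotone, hence almost everywhere measurable, but v is controlled only on the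
  -- rectangle. Precomposing with projections makes it continuous on the whole plane.
  let V : ℝ × ℝ → ℝ := fun p => M.v (projIcc 0 M.qmax M.qmax_pos.le p.1) (projIcc M.a M.b hab p.2)
  have hV : Continuous V :=
    M.v_continuousOn.comp_continuous (f := fun p : ℝ × ℝ =>
      ((projIcc 0 M.qmax M.qmax_pos.le p.1 : ℝ), (projIcc M.a M.b hab p.2 : ℝ)))
      (by fun_prop) (fun p => ⟨Subtype.prop _, Subtype.prop _⟩)
  have hqm : AEMeasurable q (volume.restrict (Icc M.a M.b)) :=
    aemeasurable_restrict_of_monotoneOn measurableSet_Icc hm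
  have hVm : AEMeasurable (fun θ => V (q θ, θ)) (volume.restrict (Icc M.a M.b)) :=
    hV.measurable.comp_aemeasurable (hqm.prodMk aemeasurable_id)
  have hfm : AEMeasurable M.f (volume.restrict (Icc M.a M.b)) :=
    M.f_cont.aemeasurable measurableSet_Icc
  have hVeq : ∀ θ ∈ Icc M.a M.b, V (q θ, θ) = M.v (q θ) θ := fun θ hθ => by
    simp only [V]
    rw [projIcc_of_mem _ (hq θ hθ), projIcc_of_mem _ hθ]
  have hI : IntegrableOn (fun θ => V (q θ, θ) * M.f θ) (Icc M.a M.b) := by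
    refine Integrable.of_bound (hVm.mul hfm).aestronglyMeasurable (L * B) ?_
    filter_upwards [ae_restrict_mem measurableSet_Icc] with θ hθ
    rw [hVeq θ hθ, norm_mul]
    exact mul_le_mul (hL _ (hq θ hθ) _ hθ) (hB θ hθ) (norm_nonneg _) hL0
  exact hI.congr_fun (fun θ hθ => by simp only [hVeq θ hθ]) measurableSet_Icc

theorem f_mul_intervalIntegrable {w : ℝ → ℝ} (hw : IntervalIntegrable w volume M.a M.b) :
    IntervalIntegrable (fun θ => w θ * M.f θ) volume M.a M.b :=
  hw.mul_continuousOn (by rw [uIcc_of_le M.a_lt_b.le]; exact M.f_cont)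

/-! ### Full separation -/

variable {M} {w0 : ℝ} {qf : ℝ → ℝ}

namespace IsFullSeparationQuality

variable (h : M.IsFullSeparationQuality w0 qf)
include h

theorem mem_Icc {θ : ℝ} (hθ : θ ∈ Icc M.a M.b) : qf θ ∈ Icc 0 M.qmax :=
  Ico_subset_Icc_self (h.mem θ hθ)

theorem cost_continuousOn : ContinuousOn (fun θ => M.c (qf θ)) (Icc M.a M.b) :=
  M.c_continuousOn.comp h.cont fun _ hθ => h.mem_Icc hθ

/-- The first-order condition says that the derivative of c(qf(θ)) is θ. Integrate from a, where the
binding participation constraint gives c(qf(a)) = a² − w0 a. -/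
theorem cost_eq {θ : ℝ} (hθ : θ ∈ Icc M.a M.b) :
    M.c (qf θ) = θ ^ 2 / 2 + M.a ^ 2 / 2 - w0 * M.a := by
  have hd : ∀ x ∈ Ioo M.a M.b, HasDerivAt (fun θ => M.c (qf θ)) x x := fun x hx => by
    have hx' := Ioo_subset_Icc_self hx
    have h1 := (M.c_smooth.differentiableOn (by norm_num) _ (h.mem_Icc hx')).hasDerivWithinAt
    have h2 := (h.diff x hx).hasDerivAt.hasDerivWithinAt (s := Icc M.a M.b)
    have h3 := h1.comp x h2 (fun y hy => h.mem_Icc hy)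
    have h4 := h3.hasDerivAt (Icc_mem_nhds hx.1 hx.2)
    have h5 : derivWithin M.c (Icc 0 M.qmax) (qf x) * deriv qf x = x := h.foc x hx
    rwa [h5] at h4
  have key := intervalIntegral.integral_eq_sub_of_hasDerivAt_of_le (f' := fun x => x) hθ.1
    (h.cost_continuousOn.mono (Icc_subset_Icc_right hθ.2))
    (fun x hx => hd x ⟨hx.1, hx.2.trans_le hθ.2⟩) (continuous_id.intervalIntegrable _ _)
  rw [integral_id] at key
  have := h.ir_binds
  linarith

theorem strictMonoOn : StrictMonoOn qf (Icc M.a M.b) := by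
  intro x hx y hy hxy
  have h1 := h.cost_eq hx
  have h2 := h.cost_eq hy
  rw [← M.c_strictMonoOn.lt_iff_lt (h.mem_Icc hx) (h.mem_Icc hy), h1, h2]
  have := M.a_nonneg
  have := hx.1
  nlinarith

theorem pos {θ : ℝ} (hθ : θ ∈ Ioc M.a M.b) : 0 < qf θ :=
  (h.mem M.a (left_mem_Icc.2 M.a_lt_b.le)).1.trans_lt
    (h.strictMonoOn (left_mem_Icc.2 M.a_lt_b.le) (Ioc_subset_Icc_self hθ) hθ.1)

theorem c'_pos {θ : ℝ} (hθ : θ ∈ Ioc M.a M.b) : 0 < M.c' (qf θ) :=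
  M.c'_pos ⟨h.pos hθ, (h.mem_Icc (Ioc_subset_Icc_self hθ)).2⟩

theorem c'_continuousOn : ContinuousOn (fun θ => M.c' (qf θ)) (Icc M.a M.b) :=
  M.c'_continuousOn.comp h.cont fun _ hθ => h.mem_Icc hθ

theorem vq_continuousOn : ContinuousOn (fun θ => M.vq (qf θ) θ) (Icc M.a M.b) :=
  M.vq_continuousOn.comp (h.cont.prodMk continuousOn_id) fun _ hθ => ⟨h.mem_Icc hθ, hθ⟩

theorem ratio_continuousOn :
    ContinuousOn (fun θ => M.vq (qf θ) θ / M.c' (qf θ)) (Ioc M.a M.b) :=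
  (h.vq_continuousOn.mono Ioc_subset_Icc_self).div (h.c'_continuousOn.mono Ioc_subset_Icc_self)
    fun _ hθ => (h.c'_pos hθ).ne'

theorem weight_continuousOn :
    ContinuousOn (fun θ => M.vq (qf θ) θ / M.c' (qf θ) * M.f θ) (Ioc M.a M.b) :=
  (h.ratio_continuousOn).mul (M.f_cont.mono Ioc_subset_Icc_self)

/-- The integrand is qf' by the first-order condition. This bound on ∫ x / c' controls the possible
singularity of 1 / c' at the lowest type. -/
theorem integral_id_div_c' {s : ℝ} (hs : s ∈ Ioo M.a M.b) :
    ∫ x in s..M.b, x / M.c' (qf x) = qf M.b - qf s := by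
  have hsub : Icc s M.b ⊆ Ioc M.a M.b := fun x hx => ⟨hs.1.trans_le hx.1, hx.2⟩
  refine intervalIntegral.integral_eq_sub_of_hasDerivAt_of_le hs.2.le
    (h.cont.mono (hsub.trans Ioc_subset_Icc_self)) (fun x hx => ?_) ?_
  · have hx' : x ∈ Ioo M.a M.b := ⟨hs.1.trans hx.1, hx.2⟩
    have := (h.diff x hx').hasDerivAt
    have hfoc : deriv qf x = x / M.c' (qf x) :=
      eq_div_of_mul_eq (h.c'_pos (Ioo_subset_Ioc_self hx')).ne'
        (by rw [mul_comm]; exact h.foc x hx')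
    rwa [hfoc] at this
  · refine ContinuousOn.intervalIntegrable ?_
    rw [uIcc_of_le hs.2.le]
    exact continuousOn_id.div (h.c'_continuousOn.mono (hsub.trans Ioc_subset_Icc_self))
      fun x hx => (h.c'_pos (hsub hx)).ne'

/-- The left end point is excluded because c'(qf(a)) may be zero. Near any other point the tail
integral can be started at some s > a. -/
theorem J_continuousOn : ContinuousOn (M.J qf) (Ioc M.a M.b) := by
  have hG : ContinuousOn
      (fun θ => ∫ x in θ..M.b, M.vq (qf x) x / M.c' (qf x) * M.f x) (Ioc M.a M.b) := by
    intro θ hθ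
    obtain ⟨s, hs1, hs2⟩ := exists_between hθ.1
    have hsb : s ≤ M.b := hs2.le.trans hθ.2
    have hsub : Icc s M.b ⊆ Ioc M.a M.b := fun x hx => ⟨hs1.trans_le hx.1, hx.2⟩
    have hint : IntegrableOn (fun x => M.vq (qf x) x / M.c' (qf x) * M.f x) (uIcc s M.b) := by
      rw [uIcc_of_le hsb]
      exact ((h.weight_continuousOn).mono hsub).integrableOn_Icc
    have := intervalIntegral.continuousOn_primitive_interval_left hint
    rw [uIcc_of_le hsb] at this
    refine (this θ ⟨hs2.le, hθ.2⟩).mono_of_mem_nhdsWithin ?_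
    rw [mem_nhdsWithin]
    exact ⟨Ioi s, isOpen_Ioi, hs2, fun x hx => ⟨hx.1.le, hx.2.2⟩⟩
  refine ContinuousOn.sub ?_ (hG.div (M.f_cont.mono Ioc_subset_Icc_self)
    fun θ hθ => (M.f_pos θ (Ioc_subset_Icc_self hθ)).ne')
  exact ((h.vq_continuousOn.mono Ioc_subset_Icc_self).mul continuousOn_id).div
    (h.c'_continuousOn.mono Ioc_subset_Icc_self) fun _ hθ => (h.c'_pos hθ).ne'

end IsFullSeparationQuality

end SignalingModel

end

noncomputable section

/-! ### Integrals of real functions -/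

/-- Integration by parts for two absolutely continuous primitives, so that `d` need only be
integrable; here it will be the wage change, which may jump. -/
theorem integral_mul_primitive_eq {k d : ℝ → ℝ} {s t : ℝ} (hst : s ≤ t)
    (hk : ContinuousOn k (Icc s t)) (hd : IntervalIntegrable d volume s t) :
    ∫ x in s..t, k x * ∫ y in s..x, d y = ∫ x in s..t, d x * ∫ y in x..t, k y := by
  rw [← uIcc_of_le hst] at hk
  have hki : IntervalIntegrable k volume s t := hk.intervalIntegrable
  have hA := hd.absolutelyContinuousOnInterval_intervalIntegral (c := s) left_mem_uIcc
  have hB := hki.absolutelyContinuousOnInterval_intervalIntegral (c := t) right_mem_uIcc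
  have key := hA.integral_mul_deriv_eq_deriv_mul hB
  simp only [intervalIntegral.integral_same, mul_zero, zero_mul, sub_zero, zero_sub] at key
  have h1 : ∫ x in s..t, k x * ∫ y in s..x, d y =
      ∫ x in s..t, (∫ y in s..x, d y) * deriv (fun x => ∫ y in t..x, k y) x := by
    refine intervalIntegral.integral_congr_ae ?_
    filter_upwards [hki.ae_hasDerivAt_integral] with x hx hx'
    rw [(hx (uIoc_subset_uIcc hx') t right_mem_uIcc).deriv, mul_comm]
  have h2 : ∫ x in s..t, d x * ∫ y in x..t, k y =
      - ∫ x in s..t, deriv (fun x => ∫ y in s..x, d y) x * ∫ y in t..x, k y := by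
    rw [← intervalIntegral.integral_neg]
    refine intervalIntegral.integral_congr_ae ?_
    filter_upwards [hd.ae_hasDerivAt_integral] with x hx hx'
    rw [(hx (uIoc_subset_uIcc hx') s left_mem_uIcc).deriv, intervalIntegral.integral_symm t x,
      mul_neg]
  rw [h1, h2, key]

/-- A monotone weight, against a function all of whose upper tails have nonpositive integral. -/
theorem integral_mul_le_of_monotoneOn {j k : ℝ → ℝ} {s t : ℝ} (hst : s ≤ t)
    (hj : ContinuousOn j (Icc s t)) (hm : MonotoneOn j (Icc s t))
    (hk : IntervalIntegrable k volume s t) (htail : ∀ x ∈ Icc s t, ∫ y in x..t, k y ≤ 0) :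
    ∫ x in s..t, j x * k x ≤ j s * ∫ x in s..t, k x := by
  set N : ℝ := j t - j s
  have hsI : s ∈ Icc s t := left_mem_Icc.2 hst
  have htI : t ∈ Icc s t := right_mem_Icc.2 hst
  have hN : 0 ≤ N := sub_nonneg.2 (hm hsI htI hst)
  let e : ℝ → ℝ := fun x => j (projIcc s t hst x) - j s
  have he : Continuous e := (hj.comp_continuous (f := fun x => (projIcc s t hst x : ℝ))
    (by fun_prop) (fun x => Subtype.prop _)).sub continuous_const
  have heq : ∀ x ∈ Icc s t, e x = j x - j s := fun x hx => by
    simp only [e]; rw [projIcc_of_mem _ hx]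
  have hp : ∀ x, (projIcc s t hst x : ℝ) ∈ Icc s t := fun x => Subtype.prop _
  have he0 : ∀ x, 0 ≤ e x := fun x => sub_nonneg.2 (hm hsI (hp x) (hp x).1)
  have heN : ∀ x, e x ≤ N := fun x =>
    sub_le_sub_right (hm (hp x) htI (hp x).2) _
  have hem : Monotone e := fun x y hxy =>
    sub_le_sub_right (hm (hp x) (hp y) (monotone_projIcc hst hxy)) _
  -- layer cake
  have hlayer : ∀ x, e x = ∫ r in (0 : ℝ)..N, (Iio (e x)).indicator (fun _ => (1 : ℝ)) r := by
    intro x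
    rw [intervalIntegral.integral_of_le hN, setIntegral_indicator measurableSet_Iio]
    have : ∫ _ in Ioc 0 N ∩ Iio (e x), (1 : ℝ) = ∫ _ in Ioo 0 (e x), (1 : ℝ) := by
      congr 2
      ext r
      simp only [mem_inter_iff, mem_Ioc, mem_Iio, mem_Ioo]
      have := heN x
      constructor
      · rintro ⟨⟨h1, h2⟩, h3⟩; exact ⟨h1, h3⟩
      · rintro ⟨h1, h3⟩; exact ⟨⟨h1, by linarith⟩, h3⟩
    rw [this]
    simp [he0 x]
  -- By Fubini the integral is an average over levels r of ∫ k over {e > r}. As `e` is continuous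
  -- and monotone, each such set is an upper interval or empty, and `htail` applies.
  have hmain : ∫ x in s..t, e x * k x ≤ 0 := by
    have h1 : ∫ x in s..t, e x * k x = ∫ x in Ioc s t, ∫ r in Ioc 0 N,
        (Iio (e x)).indicator (fun _ => (1 : ℝ)) r * k x := by
      rw [intervalIntegral.integral_of_le hst]
      refine integral_congr_ae (Filter.Eventually.of_forall fun x => ?_)
      simp only
      rw [integral_mul_const]
      congr 1
      rw [← intervalIntegral.integral_of_le hN]
      exact hlayer x
    have hmeas : MeasurableSet {p : ℝ × ℝ | p.2 < e p.1} :=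
      measurableSet_lt measurable_snd (he.measurable.comp measurable_fst)
    have hint : Integrable (Function.uncurry fun x r =>
        (Iio (e x)).indicator (fun _ => (1 : ℝ)) r * k x)
        ((volume.restrict (Ioc s t)).prod (volume.restrict (Ioc 0 N))) := by
      have hk' : Integrable k (volume.restrict (Ioc s t)) :=
        (intervalIntegrable_iff_integrableOn_Ioc_of_le hst).1 hk
      have h2 : Integrable (fun p : ℝ × ℝ => k p.1)
          ((volume.restrict (Ioc s t)).prod (volume.restrict (Ioc 0 N))) := hk'.comp_fst _
      refine (h2.indicator hmeas).congr (Filter.Eventually.of_forall fun p => ?_)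
      simp only [indicator, Function.uncurry, mem_ofPred_eq, mem_Iio]
      split_ifs <;> simp
    rw [h1, integral_integral_swap hint]
    refine setIntegral_nonpos measurableSet_Ioc fun r hr => ?_
    have h3 : ∀ x, (Iio (e x)).indicator (fun _ => (1 : ℝ)) r * k x =
        {x | r < e x}.indicator k x := fun x => by
      simp only [indicator, mem_Iio, mem_ofPred_eq]; split_ifs <;> simp
    simp only [h3]
    have hms : MeasurableSet {x | r < e x} := measurableSet_lt measurable_const he.measurable
    rw [setIntegral_indicator hms]
    by_cases hrN : r < N
    · -- the superlevel set is an upper interval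
      obtain ⟨z, hz, hzr⟩ : ∃ z ∈ Icc s t, e z = r := by
        have hes : e s = 0 := by rw [heq s hsI, sub_self]
        have het : e t = N := heq t htI
        have := intermediate_value_Icc hst he.continuousOn
        rw [hes, het] at this
        exact this ⟨hr.1.le, hrN.le⟩
      let Z : Set ℝ := {x | x ∈ Icc s t ∧ e x ≤ r}
      have hZc : IsCompact Z := by
        have : Z = Icc s t ∩ e ⁻¹' Iic r := rfl
        rw [this]
        exact isCompact_Icc.inter_right (isClosed_Iic.preimage he)
      have hZn : Z.Nonempty := ⟨z, hz, hzr.le⟩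
      obtain ⟨y, hyZ, hy⟩ := hZc.exists_isGreatest hZn
      have hset : Ioc s t ∩ {x | r < e x} = Ioc y t := by
        ext x
        simp only [mem_inter_iff, mem_Ioc, mem_ofPred_eq]
        constructor
        · rintro ⟨⟨h4, h5⟩, h6⟩
          refine ⟨?_, h5⟩
          by_contra hxy
          exact absurd (hem (not_lt.1 hxy)) (not_le.2 (hyZ.2.trans_lt h6))
        · rintro ⟨h4, h5⟩
          refine ⟨⟨hyZ.1.1.trans_lt h4, h5⟩, ?_⟩
          by_contra h6
          exact absurd (hy ⟨⟨hyZ.1.1.trans h4.le, h5⟩, not_lt.1 h6⟩) (not_le.2 h4)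
      rw [hset, ← intervalIntegral.integral_of_le hyZ.1.2]
      exact htail y hyZ.1
    · have hset : Ioc s t ∩ {x | r < e x} = ∅ := by
        ext x
        simp only [mem_inter_iff, mem_ofPred_eq, mem_empty_iff_false, iff_false, not_and, not_lt]
        intro _
        exact (heN x).trans (not_lt.1 hrN)
      simp [hset]
  have hsplit : ∫ x in s..t, j x * k x = (∫ x in s..t, e x * k x) + j s * ∫ x in s..t, k x := by
    rw [← intervalIntegral.integral_const_mul, ← intervalIntegral.integral_add
      (hk.continuousOn_mul he.continuousOn) (hk.const_mul _)]
    refine intervalIntegral.integral_congr fun x hx => ?_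
    rw [uIcc_of_le hst] at hx
    change j x * k x = e x * k x + j s * k x
    rw [heq x hx]; ring
  linarith

/-- The average `V x / x` of an absolutely continuous function with `V ≤ x V'` increases. -/
theorem primitive_div_le {w : ℝ → ℝ} {U a s b : ℝ} (hs : 0 < s) (has : a ≤ s) (hsb : s ≤ b)
    (hw : IntervalIntegrable w volume a b)
    (h : ∀ x ∈ Icc s b, (∫ y in a..x, w y) + U ≤ x * w x) :
    ((∫ y in a..s, w y) + U) / s ≤ ((∫ y in a..b, w y) + U) / b := by
  set V : ℝ → ℝ := fun x => (∫ y in a..x, w y) + U with hV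
  have hab := has.trans hsb
  have hVc : ContinuousOn V (Icc a b) := by
    have := intervalIntegral.continuousOn_primitive_interval (a := a) (b := b) (f := w)
      (μ := volume) (by rw [uIcc_of_le hab]; exact
        (intervalIntegrable_iff_integrableOn_Icc_of_le hab).1 hw)
    rw [uIcc_of_le hab] at this
    exact this.add continuousOn_const
  have hsub : Icc s b ⊆ Icc a b := Icc_subset_Icc_left has
  have hφc : ContinuousOn (fun x => V x / x) (Icc s b) :=
    (hVc.mono hsub).div continuousOn_id fun x hx => (hs.trans_le hx.1).ne'
  have hφi : IntervalIntegrable (fun x => V x / x) volume s b :=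
    (by rw [uIcc_of_le hsb]; exact hφc : ContinuousOn _ (uIcc s b)).intervalIntegrable
  -- `w` is only integrable, so V need not be differentiable everywhere. `V1` replaces `w` by its
  -- continuous lower bound V(y)/y: it starts at V(s), stays below V, and V1' = V/x ≥ V1/x makes
  -- V1/x increase.
  set V1 : ℝ → ℝ := fun x => V s + ∫ y in s..x, V y / y with hV1
  have hle : ∀ x ∈ Icc s b, V1 x ≤ V x := fun x hx => by
    have h1 : V x - V s = ∫ y in s..x, w y := by
      simp only [hV]
      rw [← intervalIntegral.integral_add_adjacent_intervals (a := a) (b := s) (c := x)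
        (hw.mono_set (by rw [uIcc_of_le has, uIcc_of_le hab]; exact Icc_subset_Icc_right hsb))
        (hw.mono_set (by rw [uIcc_of_le hx.1, uIcc_of_le hab]; exact Icc_subset_Icc has hx.2))]
      ring
    have h2 : ∫ y in s..x, V y / y ≤ ∫ y in s..x, w y := by
      refine intervalIntegral.integral_mono_on hx.1
        (hφi.mono_set (by
          rw [uIcc_of_le hx.1, uIcc_of_le hsb]; exact Icc_subset_Icc_right hx.2))
        (hw.mono_set (by
          rw [uIcc_of_le hx.1, uIcc_of_le hab]; exact Icc_subset_Icc has hx.2)) fun y hy => ?_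
      have hy0 : 0 < y := hs.trans_le hy.1
      rw [div_le_iff₀ hy0, mul_comm]
      exact h y ⟨hy.1, hy.2.trans hx.2⟩
    simp only [hV1]
    linarith
  have hV1d : ∀ x ∈ Ioo s b, HasDerivAt V1 (V x / x) x := fun x hx => by
    have hx' := Icc_mem_nhds hx.1 hx.2
    have := intervalIntegral.integral_hasDerivAt_right (a := s) (b := x)
      (hφi.mono_set (by
        rw [uIcc_of_le hx.1.le, uIcc_of_le hsb]; exact Icc_subset_Icc_right hx.2.le))
      (hφc.stronglyMeasurableAtFilter_nhdsWithin measurableSet_Icc x |>.filter_mono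
        (by rw [nhdsWithin_eq_nhds.2 hx'])) (hφc.continuousAt hx')
    exact this.const_add _
  have hV1c : ContinuousOn V1 (Icc s b) := by
    have := intervalIntegral.continuousOn_primitive_interval (a := s) (b := b)
      (f := fun x => V x / x) (μ := volume) (by rw [uIcc_of_le hsb]; exact
        (intervalIntegrable_iff_integrableOn_Icc_of_le hsb).1 hφi)
    rw [uIcc_of_le hsb] at this
    exact continuousOn_const.add this
  have hmono : MonotoneOn (fun x => V1 x / x) (Icc s b) := by
    have hdd : ∀ x ∈ Ioo s b, HasDerivAt (fun x => V1 x / x)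
        ((V x / x * x - V1 x * 1) / x ^ 2) x := fun x hx =>
      (hV1d x hx).div (hasDerivAt_id x) (hs.trans hx.1).ne'
    refine monotoneOn_of_deriv_nonneg (convex_Icc _ _)
      (hV1c.div continuousOn_id fun x hx => (hs.trans_le hx.1).ne') ?_ ?_
    · rw [interior_Icc]
      exact fun x hx => (hdd x hx).differentiableAt.differentiableWithinAt
    · rw [interior_Icc]
      intro x hx
      rw [(hdd x hx).deriv]
      have hx0 : 0 < x := hs.trans hx.1
      have := hle x (Ioo_subset_Icc_self hx)
      rw [div_mul_cancel₀ _ hx0.ne']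
      exact div_nonneg (by linarith) (by positivity)
  have h1 := hmono (left_mem_Icc.2 hsb) (right_mem_Icc.2 hsb) hsb
  have h2 := hle b (right_mem_Icc.2 hsb)
  simp only [hV1, intervalIntegral.integral_same, add_zero] at h1 h2
  exact h1.trans (div_le_div_of_nonneg_right h2 (hs.le.trans hsb))

/-- The envelope formula, for a monotone selection of subgradients. -/
theorem envelope_formula {U w : ℝ → ℝ} {a b : ℝ} (hab : a ≤ b) (hw : MonotoneOn w (Icc a b))
    (h : ∀ x ∈ Icc a b, ∀ y ∈ Icc a b, U x + (y - x) * w x ≤ U y) :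
    ∀ x ∈ Icc a b, U x = (∫ y in a..x, w y) + U a := by
  intro x hx
  have hbd : ∀ y ∈ Icc a b, |w y| ≤ max |w a| |w b| := fun y hy => by
    have h1 := hw (left_mem_Icc.2 hab) hy hy.1
    have h2 := hw hy (right_mem_Icc.2 hab) hy.2
    exact abs_le_max_abs_abs h1 h2
  have hUc : ContinuousOn U (Icc a b) := by
    have hL : LipschitzOnWith (Real.toNNReal (max |w a| |w b|)) U (Icc a b) := by
      refine LipschitzOnWith.of_dist_le_mul fun y hy z hz => ?_
      rw [Real.coe_toNNReal _ (le_max_of_le_left (abs_nonneg _)), Real.dist_eq, Real.dist_eq]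
      set L := max |w a| |w b|
      have h1 := h y hy z hz
      have h2 := h z hz y hy
      have h3 : |(z - y) * w y| ≤ L * |y - z| := by
        rw [abs_mul, abs_sub_comm, mul_comm]
        exact mul_le_mul_of_nonneg_right (hbd y hy) (abs_nonneg _)
      have h4 : |(y - z) * w z| ≤ L * |y - z| := by
        rw [abs_mul, mul_comm]
        exact mul_le_mul_of_nonneg_right (hbd z hz) (abs_nonneg _)
      rw [abs_le] at h3 h4 ⊢
      constructor <;> linarith
    exact hL.continuousOn
  -- `U` has derivative `w` wherever `w` is continuous, hence off a countable set. For a continuous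
  -- `U` this suffices for the fundamental theorem of calculus.
  have hcount := hw.countable_not_continuousWithinAt
  have key := MeasureTheory.integral_eq_of_hasDerivAt_off_countable_of_le U w hx.1 hcount
    (hUc.mono (Icc_subset_Icc_right hx.2)) (fun y hy => ?_)
    ((hw.mono (by rw [uIcc_of_le hx.1]; exact Icc_subset_Icc_right hx.2)).intervalIntegrable)
  · linarith
  · have hy' : y ∈ Icc a b := ⟨hy.1.1.le, hy.1.2.le.trans hx.2⟩
    have hn : Icc a b ∈ nhds y := Icc_mem_nhds hy.1.1 (hy.1.2.trans_le hx.2)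
    have hc : ContinuousAt w y := by
      have : ContinuousWithinAt w (Icc a b) y := by
        by_contra hcon
        exact hy.2 ⟨hy', hcon⟩
      exact this.continuousAt hn
    rw [hasDerivAt_iff_isLittleO, Asymptotics.isLittleO_iff]
    intro ε hε
    have := Metric.continuousAt_iff'.1 hc ε hε
    filter_upwards [this, hn] with z hz hz'
    rw [Real.dist_eq] at hz
    have h1 := h y hy' z hz'
    have h2 := h z hz' y hy'
    simp only [smul_eq_mul, Real.norm_eq_abs]
    have h3 : |(z - y) * (w z - w y)| ≤ ε * |z - y| := by
      rw [abs_mul, mul_comm]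
      exact mul_le_mul_of_nonneg_right hz.le (abs_nonneg _)
    rw [abs_le] at h3 ⊢
    constructor <;> nlinarith

end

/-! ### Sufficiency: the payoff bound when `J` increases. -/

noncomputable section

theorem IntervalIntegrable.mono_Icc {w : ℝ → ℝ} {a b s t : ℝ}
    (hw : IntervalIntegrable w volume a b) (has : a ≤ s) (hst : s ≤ t) (htb : t ≤ b) :
    IntervalIntegrable w volume s t :=
  hw.mono_set (by
    rw [uIcc_of_le hst, uIcc_of_le ((has.trans hst).trans htb)]; exact Icc_subset_Icc has htb)

namespace SignalingModel

variable (M : SignalingModel)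

/-- The density-weighted ratio of marginal payoff to marginal cost along `qf`. -/
def weight (qf : ℝ → ℝ) (θ : ℝ) : ℝ := M.vq (qf θ) θ / M.c' (qf θ) * M.f θ

variable {M} {w0 : ℝ} {qf : ℝ → ℝ}

theorem J_mul_f {θ : ℝ} (hθ : θ ∈ Icc M.a M.b) :
    M.J qf θ * M.f θ = θ * M.weight qf θ - ∫ x in θ..M.b, M.weight qf x := by
  have hf := (M.f_pos θ hθ).ne'
  unfold J weight
  field_simp

namespace IsFullSeparationQuality

variable (h : M.IsFullSeparationQuality w0 qf)
include h

theorem weight_intervalIntegrable {s t : ℝ} (hs : M.a < s) (hst : s ≤ t) (htb : t ≤ M.b) :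
    IntervalIntegrable (M.weight qf) volume s t := by
  refine ContinuousOn.intervalIntegrable ?_
  rw [uIcc_of_le hst]
  exact h.weight_continuousOn.mono fun x hx => ⟨hs.trans_le hx.1, hx.2.trans htb⟩

theorem weight_nonneg (hb : ∀ θ ∈ Icc M.a M.b, 0 ≤ M.vq (qf θ) θ) {θ : ℝ}
    (hθ : θ ∈ Ioc M.a M.b) : 0 ≤ M.weight qf θ :=
  mul_nonneg (div_nonneg (hb θ (Ioc_subset_Icc_self hθ)) (h.c'_pos hθ).le)
    (M.f_pos θ (Ioc_subset_Icc_self hθ)).le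

/-- Exchanging the order of integration turns the weight times ∫_s^θ d into d times the tail of the
weight; `J_mul_f` then collects the terms into J f. -/
theorem integral_weight_mul {s : ℝ} (hs : s ∈ Ioo M.a M.b) {d : ℝ → ℝ}
    (hd : IntervalIntegrable d volume s M.b) :
    ∫ θ in s..M.b, M.weight qf θ * (θ * d θ - ∫ x in s..θ, d x) =
      ∫ θ in s..M.b, M.J qf θ * (d θ * M.f θ) := by
  have hsub : Icc s M.b ⊆ Ioc M.a M.b := fun x hx => ⟨hs.1.trans_le hx.1, hx.2⟩
  have hW : ContinuousOn (M.weight qf) (Icc s M.b) := h.weight_continuousOn.mono hsub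
  have hu := uIcc_of_le hs.2.le
  have hWi := h.weight_intervalIntegrable hs.1 hs.2.le le_rfl
  have hI1 : IntervalIntegrable (fun θ => (M.weight qf θ * θ) * d θ) volume s M.b :=
    hd.continuousOn_mul (by rw [hu]; exact hW.mul continuousOn_id)
  have hprim : ContinuousOn (fun θ => ∫ x in s..θ, d x) (uIcc s M.b) :=
    intervalIntegral.continuousOn_primitive_interval (by
      rw [hu]; exact (intervalIntegrable_iff_integrableOn_Icc_of_le hs.2.le).1 hd)
  have hprim' : ContinuousOn (fun θ => ∫ x in θ..M.b, M.weight qf x) (uIcc s M.b) :=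
    intervalIntegral.continuousOn_primitive_interval_left (by
      rw [hu]; exact (intervalIntegrable_iff_integrableOn_Icc_of_le hs.2.le).1 hWi)
  have hI2 : IntervalIntegrable (fun θ => M.weight qf θ * ∫ x in s..θ, d x) volume s M.b :=
    hWi.mul_continuousOn hprim
  have hI3 : IntervalIntegrable (fun θ => d θ * ∫ x in θ..M.b, M.weight qf x) volume s M.b :=
    hd.mul_continuousOn hprim'
  have h1 : ∫ θ in s..M.b, M.weight qf θ * (θ * d θ - ∫ x in s..θ, d x) =
      (∫ θ in s..M.b, (M.weight qf θ * θ) * d θ) -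
        ∫ θ in s..M.b, M.weight qf θ * ∫ x in s..θ, d x := by
    rw [← intervalIntegral.integral_sub hI1 hI2]
    exact intervalIntegral.integral_congr fun θ _ => by ring
  rw [h1, integral_mul_primitive_eq hs.2.le hW hd, ← intervalIntegral.integral_sub hI1 hI3]
  refine intervalIntegral.integral_congr fun θ hθ => ?_
  rw [hu] at hθ
  have := J_mul_f (qf := qf) (Ioc_subset_Icc_self (hsub hθ))
  linear_combination -(d θ) * this

/-- Since s ≤ x on the tail, s times the tail is at most ∫ x v_q f / c' = ∫ v_q f qf', and qf rises
by at most `qmax`. -/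
theorem exists_mul_tail_weight_le (hb : ∀ θ ∈ Icc M.a M.b, 0 ≤ M.vq (qf θ) θ) :
    ∃ B : ℝ, 0 ≤ B ∧ ∀ s ∈ Ioo M.a M.b, s * ∫ x in s..M.b, M.weight qf x ≤ B := by
  obtain ⟨L, hL0, hL⟩ := M.exists_vq_bound
  obtain ⟨B, hB0, hB⟩ := M.exists_f_bound
  refine ⟨L * B * M.qmax, mul_nonneg (mul_nonneg hL0 hB0) M.qmax_pos.le, fun s hs => ?_⟩
  have hsub : Icc s M.b ⊆ Ioc M.a M.b := fun x hx => ⟨hs.1.trans_le hx.1, hx.2⟩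
  have hWi := h.weight_intervalIntegrable hs.1 hs.2.le le_rfl
  have hs0 : 0 < s := M.a_nonneg.trans_lt hs.1
  have hc : IntervalIntegrable (fun x => x / M.c' (qf x)) volume s M.b := by
    refine ContinuousOn.intervalIntegrable ?_
    rw [uIcc_of_le hs.2.le]
    exact continuousOn_id.div (h.c'_continuousOn.mono (hsub.trans Ioc_subset_Icc_self))
      fun x hx => (h.c'_pos (hsub hx)).ne'
  rw [← intervalIntegral.integral_const_mul]
  calc ∫ x in s..M.b, s * M.weight qf x
      ≤ ∫ x in s..M.b, L * B * (x / M.c' (qf x)) := by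
        refine intervalIntegral.integral_mono_on hs.2.le (hWi.const_mul _) (hc.const_mul _)
          fun x hx => ?_
        have hx' := hsub hx
        have hxI := Ioc_subset_Icc_self hx'
        have hc' := h.c'_pos hx'
        have h1 : M.vq (qf x) x ≤ L := (le_abs_self _).trans (hL _ (h.mem_Icc hxI) _ hxI)
        have h2 : M.f x ≤ B := (le_abs_self _).trans (hB _ hxI)
        have h3 := hb x hxI
        have h4 := (M.f_pos x hxI).le
        have h5 : M.vq (qf x) x * M.f x ≤ L * B := mul_le_mul h1 h2 h4 hL0
        have h6 : 0 ≤ x / M.c' (qf x) := div_nonneg (hs0.le.trans hx.1) hc'.le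
        calc s * M.weight qf x ≤ x * M.weight qf x :=
              mul_le_mul_of_nonneg_right hx.1 (h.weight_nonneg hb hx')
          _ = M.vq (qf x) x * M.f x * (x / M.c' (qf x)) := by unfold weight; ring
          _ ≤ _ := mul_le_mul_of_nonneg_right h5 h6
    _ = L * B * (qf M.b - qf s) := by
        rw [intervalIntegral.integral_const_mul, h.integral_id_div_c' hs]
    _ ≤ L * B * M.qmax := by
        refine mul_le_mul_of_nonneg_left ?_ (mul_nonneg hL0 hB0)
        have h1 := (h.mem_Icc (right_mem_Icc.2 M.a_lt_b.le)).2
        have h2 := (h.mem_Icc (Ioo_subset_Icc_self hs)).1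
        linarith

end IsFullSeparationQuality

namespace Admissible

variable {q w : ℝ → ℝ} (hA : M.Admissible w0 q w)
include hA

/-- Both schemes satisfy the envelope formula. The constants compare because participation of the
lowest type is slack or binding for `q` and binds for `qf`. -/
theorem cost_le (h : M.IsFullSeparationQuality w0 qf) {θ : ℝ} (hθ : θ ∈ Icc M.a M.b) :
    M.c (q θ) - M.c (qf θ) ≤ θ * (w θ - θ) - ∫ x in M.a..θ, (w x - x) := by
  obtain ⟨U, hU⟩ := hA.ic_env
  have haI : M.a ∈ Icc M.a M.b := left_mem_Icc.2 M.a_lt_b.le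
  have h1 := hU θ hθ
  have h2 := hU M.a haI
  have h3 := hA.ir M.a haI
  rw [intervalIntegral.integral_same] at h2
  rw [h.cost_eq hθ, intervalIntegral.integral_sub (g := fun x => x)
    (hA.wage_integrable.mono_Icc le_rfl hθ.1 hθ.2) (continuous_id.intervalIntegrable _ _),
    integral_id]
  linarith

/-- The factor s matters when a = 0, where the bound must shrink with s. Nonnegative costs give
∫_a^x w + U ≤ x w(x), so `primitive_div_le` bounds (∫_a^s w + U)/s by its value at b, and |w − x| ≤
w + x. -/
theorem exists_integral_abs_le (hw0 : w0 ∈ Icc 0 M.a) :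
    ∃ B : ℝ, 0 ≤ B ∧ ∀ s ∈ Ioo M.a M.b, ∫ x in M.a..s, |w x - x| ≤ B * s := by
  obtain ⟨U, hU⟩ := hA.ic_env
  have hb0 : 0 < M.b := M.a_nonneg.trans_lt M.a_lt_b
  have haI : M.a ∈ Icc M.a M.b := left_mem_Icc.2 M.a_lt_b.le
  have hU0 : 0 ≤ U := by
    have h2 := hU M.a haI
    have h3 := hA.ir M.a haI
    rw [intervalIntegral.integral_same] at h2
    have := mul_nonneg hw0.1 M.a_nonneg
    linarith
  have hwnn : 0 ≤ ∫ x in M.a..M.b, w x :=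
    intervalIntegral.integral_nonneg M.a_lt_b.le hA.wage_nonneg
  refine ⟨((∫ x in M.a..M.b, w x) + U) / M.b + M.b, by positivity, fun s hs => ?_⟩
  have hs0 : 0 < s := M.a_nonneg.trans_lt hs.1
  have hV := primitive_div_le (U := U) hs0 hs.1.le hs.2.le hA.wage_integrable fun x hx => by
    have hx' : x ∈ Icc M.a M.b := ⟨hs.1.le.trans hx.1, hx.2⟩
    have h1 := hU x hx'
    have h2 := M.c_nonneg (hA.quality_mem x hx')
    linarith
  rw [div_le_iff₀ hs0] at hV
  have hws := hA.wage_integrable.mono_Icc le_rfl hs.1.le hs.2.le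
  have hid : IntervalIntegrable (fun x : ℝ => x) volume M.a s :=
    continuous_id.intervalIntegrable _ _
  have h1 : ∫ x in M.a..s, |w x - x| ≤ ∫ x in M.a..s, (w x + x) := by
    refine intervalIntegral.integral_mono_on hs.1.le (hws.sub hid).abs (hws.add hid)
      fun x hx => ?_
    have := hA.wage_nonneg x ⟨hx.1, hx.2.trans hs.2.le⟩
    have := M.a_nonneg.trans hx.1
    rw [abs_le]; constructor <;> linarith
  rw [intervalIntegral.integral_add hws hid, integral_id] at h1
  have h2 : (s ^ 2 - M.a ^ 2) / 2 ≤ M.b * s := by nlinarith [hs.2, sq_nonneg M.a]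
  linarith

/-- Pointwise, the tangent inequalities for v and c combine with `cost_le`; multiplying by the
weight needs v_q ≥ 0. The last term is the part of ∫_a^θ (w − x) accumulated below s. -/
theorem integral_payoff_sub_le (h : M.IsFullSeparationQuality w0 qf)
    (hb : ∀ θ ∈ Icc M.a M.b, 0 ≤ M.vq (qf θ) θ) {s : ℝ} (hs : s ∈ Ioo M.a M.b) :
    ∫ θ in s..M.b, (M.v (q θ) θ * M.f θ - M.v (qf θ) θ * M.f θ) ≤
      (∫ θ in s..M.b, M.J qf θ * ((w θ - θ) * M.f θ)) -
        (∫ θ in s..M.b, M.weight qf θ) * ∫ x in M.a..s, (w x - x) := by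
  have hsub : Icc s M.b ⊆ Ioc M.a M.b := fun x hx => ⟨hs.1.trans_le hx.1, hx.2⟩
  have hu := uIcc_of_le hs.2.le
  have hDi : IntervalIntegrable (fun x => w x - x) volume M.a M.b :=
    hA.wage_integrable.sub (continuous_id.intervalIntegrable _ _)
  have hDs := hDi.mono_Icc hs.1.le hs.2.le le_rfl
  have hWi := h.weight_intervalIntegrable hs.1 hs.2.le le_rfl
  have hprim : ContinuousOn (fun θ => ∫ x in s..θ, (w x - x)) (uIcc s M.b) :=
    intervalIntegral.continuousOn_primitive_interval (by
      rw [hu]; exact (intervalIntegrable_iff_integrableOn_Icc_of_le hs.2.le).1 hDs)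
  have hW : ContinuousOn (M.weight qf) (uIcc s M.b) := by
    rw [hu]; exact h.weight_continuousOn.mono hsub
  have hIa : IntervalIntegrable
      (fun θ => M.weight qf θ * (θ * (w θ - θ) - ∫ x in s..θ, (w x - x))) volume s M.b :=
    ((hDs.continuousOn_mul continuousOn_id).sub hprim.intervalIntegrable).continuousOn_mul hW
  rw [← h.integral_weight_mul hs hDs, ← intervalIntegral.integral_mul_const,
    ← intervalIntegral.integral_sub hIa (hWi.mul_const _)]
  refine intervalIntegral.integral_mono_on hs.2.le
    (((M.payoff_integrable hA.quality_mem hA.ic_mon).sub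
      (M.payoff_integrable (fun _ => h.mem_Icc) h.strictMonoOn.monotoneOn)).mono_Icc
        hs.1.le hs.2.le le_rfl) (hIa.sub (hWi.mul_const _)) fun θ hθ => ?_
  have hθ' := hsub hθ
  have hθI := Ioc_subset_Icc_self hθ'
  have hc' := h.c'_pos hθ'
  have h1 := M.v_tangent hθI (h.mem_Icc hθI) (hA.quality_mem θ hθI)
  have h2 := M.c_tangent (h.mem_Icc hθI) (hA.quality_mem θ hθI)
  have h3 := hA.cost_le h hθI
  have h4 : ∫ x in M.a..θ, (w x - x) = (∫ x in M.a..s, (w x - x)) + ∫ x in s..θ, (w x - x) :=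
    (intervalIntegral.integral_add_adjacent_intervals (hDi.mono_Icc le_rfl hs.1.le hs.2.le)
      (hDi.mono_Icc hs.1.le hθ.1 hθ.2)).symm
  have hf := M.f_pos θ hθI
  calc M.v (q θ) θ * M.f θ - M.v (qf θ) θ * M.f θ
      = (M.v (q θ) θ - M.v (qf θ) θ) * M.f θ := by ring
    _ ≤ (M.vq (qf θ) θ * (q θ - qf θ)) * M.f θ :=
        mul_le_mul_of_nonneg_right (by linarith) hf.le
    _ = M.weight qf θ * (M.c' (qf θ) * (q θ - qf θ)) := by
        unfold weight; field_simp
    _ ≤ M.weight qf θ * (θ * (w θ - θ) - ∫ x in M.a..θ, (w x - x)) :=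
        mul_le_mul_of_nonneg_left (by linarith) (h.weight_nonneg hb hθ')
    _ = _ := by rw [h4]; ring

/-- Write G for the tail of the weight W, K = ∫_a^s (w − x) f and I = ∫_a^s (w − x). Since J(s)
contains −G/f(s), the boundary terms −J(s) K − G I equal (G/f(s)) (K − f(s) I) − (s W(s)/f(s)) K.
The second term is nonpositive because (MPS) gives K ≥ 0, and the first involves only the
oscillation of f on [a, s]. -/
theorem integral_payoff_sub_le_tail (h : M.IsFullSeparationQuality w0 qf)
    (hb : ∀ θ ∈ Icc M.a M.b, 0 ≤ M.vq (qf θ) θ) (hJ : MonotoneOn (M.J qf) (Ioc M.a M.b))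
    {s : ℝ} (hs : s ∈ Ioo M.a M.b) :
    ∫ θ in s..M.b, (M.v (q θ) θ * M.f θ - M.v (qf θ) θ * M.f θ) ≤
      (∫ θ in s..M.b, M.weight qf θ) / M.f s *
        ∫ x in M.a..s, (w x - x) * (M.f x - M.f s) := by
  have hsub : Icc s M.b ⊆ Ioc M.a M.b := fun x hx => ⟨hs.1.trans_le hx.1, hx.2⟩
  have hDi : IntervalIntegrable (fun x => w x - x) volume M.a M.b :=
    hA.wage_integrable.sub (continuous_id.intervalIntegrable _ _)
  have hDf : IntervalIntegrable (fun x => (w x - x) * M.f x) volume M.a M.b :=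
    M.f_mul_intervalIntegrable hDi
  have hwf := M.f_mul_intervalIntegrable hA.wage_integrable
  have hxf : IntervalIntegrable (fun x => x * M.f x) volume M.a M.b :=
    M.f_mul_intervalIntegrable (w := fun x => x) (continuous_id.intervalIntegrable _ _)
  have hDf_eq : ∀ x ∈ Icc M.a M.b, ∫ y in M.a..x, (w y - y) * M.f y =
      (∫ y in M.a..x, w y * M.f y) - ∫ y in M.a..x, y * M.f y := fun x hx => by
    rw [← intervalIntegral.integral_sub (hwf.mono_Icc le_rfl hx.1 hx.2)
      (hxf.mono_Icc le_rfl hx.1 hx.2)]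
    exact intervalIntegral.integral_congr fun y _ => by ring
  have hK : ∀ x ∈ Icc M.a M.b, 0 ≤ ∫ y in M.a..x, (w y - y) * M.f y := fun x hx => by
    rw [hDf_eq x hx]; linarith [hA.mps x hx]
  have hKb : ∫ y in M.a..M.b, (w y - y) * M.f y = 0 := by
    rw [hDf_eq M.b (right_mem_Icc.2 M.a_lt_b.le)]; linarith [hA.bp]
  have htail : ∀ x ∈ Icc M.a M.b, ∫ y in x..M.b, (w y - y) * M.f y =
      -∫ y in M.a..x, (w y - y) * M.f y := fun x hx => by
    have := intervalIntegral.integral_add_adjacent_intervals (hDf.mono_Icc le_rfl hx.1 hx.2)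
      (hDf.mono_Icc hx.1 hx.2 le_rfl)
    linarith
  have hsI := Ioo_subset_Icc_self hs
  have h1 := hA.integral_payoff_sub_le h hb hs
  have h2 := integral_mul_le_of_monotoneOn hs.2.le (h.J_continuousOn.mono hsub) (hJ.mono hsub)
    (hDf.mono_Icc hs.1.le hs.2.le le_rfl) fun x hx => by
      have hxI : x ∈ Icc M.a M.b := Ioc_subset_Icc_self (hsub hx)
      rw [htail x hxI]
      linarith [hK x hxI]
  rw [htail s hsI] at h2
  have h3 : ∫ x in M.a..s, (w x - x) * (M.f x - M.f s) =
      (∫ x in M.a..s, (w x - x) * M.f x) - (∫ x in M.a..s, (w x - x)) * M.f s := by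
    rw [← intervalIntegral.integral_mul_const, ← intervalIntegral.integral_sub
      (hDf.mono_Icc le_rfl hs.1.le hs.2.le) ((hDi.mono_Icc le_rfl hs.1.le hs.2.le).mul_const _)]
    exact intervalIntegral.integral_congr fun y _ => by ring
  have hf := M.f_pos s hsI
  have h4 := hK s hsI
  have h5 : M.J qf s = (s * M.weight qf s - ∫ x in s..M.b, M.weight qf x) / M.f s :=
    eq_div_of_mul_eq hf.ne' (J_mul_f hsI)
  have h6 : 0 ≤ s * M.weight qf s / M.f s * ∫ x in M.a..s, (w x - x) * M.f x :=
    mul_nonneg (div_nonneg (mul_nonneg (M.a_nonneg.trans hs.1.le)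
      (h.weight_nonneg hb (Ioo_subset_Ioc_self hs))) hf.le) h4
  rw [h5] at h2
  rw [h3]
  refine h1.trans ?_
  refine (sub_le_sub_right h2 _).trans ?_
  have h7 : ∀ (sw G f K I : ℝ), f ≠ 0 →
      (sw - G) / f * -K - G * I = G / f * (K - I * f) - sw / f * K := fun sw G f K I hf => by
    field_simp; ring
  rw [h7 _ _ _ _ _ hf.ne']
  linarith

theorem payoff_le (hw0 : w0 ∈ Icc 0 M.a) (h : M.IsFullSeparationQuality w0 qf)
    (hb : ∀ θ ∈ Icc M.a M.b, 0 ≤ M.vq (qf θ) θ) (hJ : MonotoneOn (M.J qf) (Ioc M.a M.b)) :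
    M.payoff q ≤ M.payoff qf := by
  obtain ⟨B, hB0, hB⟩ := h.exists_mul_tail_weight_le hb
  obtain ⟨B', hB0', hB'⟩ := hA.exists_integral_abs_le hw0
  obtain ⟨l, hl0, hl⟩ := M.exists_f_lower
  have hq := M.payoff_integrable hA.quality_mem hA.ic_mon
  have hqf := M.payoff_integrable (fun _ => h.mem_Icc) h.strictMonoOn.monotoneOn
  set Φ : ℝ → ℝ := fun s => ∫ θ in s..M.b, (M.v (q θ) θ * M.f θ - M.v (qf θ) θ * M.f θ) with hΦ
  have hΦa : Φ M.a = M.payoff q - M.payoff qf := intervalIntegral.integral_sub hq hqf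
  have hab := M.a_lt_b
  have hΦc : ContinuousOn Φ (Icc M.a M.b) := by
    have := intervalIntegral.continuousOn_primitive_interval_left (a := M.a) (b := M.b)
      (μ := volume) (f := fun θ => M.v (q θ) θ * M.f θ - M.v (qf θ) θ * M.f θ) (by
        rw [uIcc_of_le hab.le]
        exact (intervalIntegrable_iff_integrableOn_Icc_of_le hab.le).1 (hq.sub hqf))
    rwa [uIcc_of_le hab.le] at this
  have haI : M.a ∈ Icc M.a M.b := left_mem_Icc.2 hab.le
  have hlim : Filter.Tendsto Φ (nhdsWithin M.a (Ioo M.a M.b)) (nhds (Φ M.a)) :=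
    (hΦc M.a haI).mono Ioo_subset_Icc_self
  have hne : (nhdsWithin M.a (Ioo M.a M.b)).NeBot := by
    rw [nhdsWithin_Ioo_eq_nhdsGT hab]; infer_instance
  have hDi : IntervalIntegrable (fun x => w x - x) volume M.a M.b :=
    hA.wage_integrable.sub (continuous_id.intervalIntegrable _ _)
  -- For s close to a, f oscillates by at most 2δ on [a, s]. The factor 1/s in the bound on the tail
  -- of the weight cancels the factor s in the bound on ∫_a^s |w − x|, leaving a bound free of s.
  have key : ∀ δ > 0, Φ M.a ≤ (B * B' / l) * (2 * δ) := by
    intro δ hδ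
    have hcont := Metric.continuousWithinAt_iff'.1 (M.f_cont M.a haI) δ hδ
    obtain ⟨u, hu, hu'⟩ := (mem_nhdsGE_iff_exists_Ico_subset).1
      (nhdsWithin_Icc_eq_nhdsGE hab ▸ hcont)
    refine le_of_tendsto hlim ?_
    have hmem : Ioo M.a (min u M.b) ∈ nhdsWithin M.a (Ioo M.a M.b) := by
      rw [nhdsWithin_Ioo_eq_nhdsGT hab]
      exact Ioo_mem_nhdsGT (lt_min hu hab)
    filter_upwards [hmem, self_mem_nhdsWithin] with s hs hs'
    have hsI := Ioo_subset_Icc_self hs'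
    have hs0 : 0 < s := M.a_nonneg.trans_lt hs'.1
    have hosc : ∀ x ∈ Icc M.a s, |M.f x - M.f s| ≤ 2 * δ := fun x hx => by
      have h1 : dist (M.f x) (M.f M.a) < δ :=
        hu' ⟨hx.1, hx.2.trans_lt (hs.2.trans_le (min_le_left _ _))⟩
      have h2 : dist (M.f s) (M.f M.a) < δ := hu' ⟨hsI.1, hs.2.trans_le (min_le_left _ _)⟩
      have h3 := dist_triangle_right (M.f x) (M.f s) (M.f M.a)
      rw [← Real.dist_eq]
      linarith
    have hint : |∫ x in M.a..s, (w x - x) * (M.f x - M.f s)| ≤ 2 * δ * (B' * s) := by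
      have hDs := hDi.mono_Icc le_rfl hsI.1 hsI.2
      calc |∫ x in M.a..s, (w x - x) * (M.f x - M.f s)|
          ≤ ∫ x in M.a..s, |(w x - x) * (M.f x - M.f s)| :=
            intervalIntegral.abs_integral_le_integral_abs hsI.1
        _ ≤ ∫ x in M.a..s, 2 * δ * |w x - x| := by
            refine intervalIntegral.integral_mono_on hsI.1 (hDs.mul_continuousOn ?_).abs
              (hDs.abs.const_mul _) fun x hx => ?_
            · rw [uIcc_of_le hsI.1]
              exact (M.f_cont.mono (Icc_subset_Icc_right hsI.2)).sub continuousOn_const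
            · rw [abs_mul, mul_comm]
              exact mul_le_mul_of_nonneg_right (hosc x hx) (abs_nonneg _)
        _ ≤ 2 * δ * (B' * s) := by
            rw [intervalIntegral.integral_const_mul]
            exact mul_le_mul_of_nonneg_left (hB' s hs') (by positivity)
    have hG : 0 ≤ ∫ x in s..M.b, M.weight qf x :=
      intervalIntegral.integral_nonneg hsI.2 fun x hx =>
        h.weight_nonneg hb ⟨hs'.1.trans_le hx.1, hx.2⟩
    have hf := M.f_pos s hsI
    calc Φ s ≤ _ := hA.integral_payoff_sub_le_tail h hb hJ hs'
      _ ≤ (∫ θ in s..M.b, M.weight qf θ) / M.f s * (2 * δ * (B' * s)) :=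
          mul_le_mul_of_nonneg_left ((le_abs_self _).trans hint) (div_nonneg hG hf.le)
      _ = (s * ∫ θ in s..M.b, M.weight qf θ) * (B' * (2 * δ)) / M.f s := by ring
      _ ≤ B * (B' * (2 * δ)) / l := by
          refine div_le_div₀ (by positivity) ?_ hl0 (hl s hsI)
          exact mul_le_mul_of_nonneg_right (hB s hs') (by positivity)
      _ = _ := by ring
  have hfin : Φ M.a ≤ 0 := by
    refine le_of_forall_pos_le_add fun ε hε => ?_
    have hk : 0 ≤ B * B' / l := by positivity
    have := key (ε / (2 * (B * B' / l + 1))) (by positivity)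
    refine this.trans ?_
    have h2 : B * B' / l * (2 * (ε / (2 * (B * B' / l + 1)))) =
        ε * (B * B' / l / (B * B' / l + 1)) := by
      field_simp
    rw [h2, zero_add]
    refine mul_le_of_le_one_right hε.le ?_
    rw [div_le_one (by positivity)]
    linarith
  linarith

end Admissible

end SignalingModel

end

/-! ### Direct mechanisms induced by equilibria. -/

noncomputable section

namespace SignalingModel

variable {M : SignalingModel}

theorem intervalIntegrable_comp_of_monotoneOn {q ψ : ℝ → ℝ} (hq : MonotoneOn q (Icc M.a M.b))
    (hψ : Measurable ψ) {B : ℝ} (hB : ∀ x, |ψ x| ≤ B) :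
    IntervalIntegrable (fun θ => ψ (q θ)) volume M.a M.b := by
  rw [intervalIntegrable_iff_integrableOn_Icc_of_le M.a_lt_b.le]
  exact Integrable.of_bound (hψ.comp_aemeasurable
    (aemeasurable_restrict_of_monotoneOn measurableSet_Icc hq)).aestronglyMeasurable B
    (Filter.Eventually.of_forall fun θ => hB (q θ))

namespace IsEquilibrium

variable {S : Type} [MeasurableSpace S] {π : Kernel ℝ S} {ω : S → ℝ} {q : ℝ → ℝ}
  (h : M.IsEquilibrium π ω q)
include h

theorem interimWage_monotoneOn :
    MonotoneOn (fun θ => interimWage π ω (q θ)) (Icc M.a M.b) := by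
  intro x hx y hy hxy
  rcases hxy.eq_or_lt with rfl | hxy
  · exact le_rfl
  have h1 := h.incentive x hx (q y) (h.quality_mem y hy)
  have h2 := h.incentive y hy (q x) (h.quality_mem x hx)
  simp only
  nlinarith

theorem quality_monotoneOn : MonotoneOn q (Icc M.a M.b) := by
  intro x hx y hy hxy
  have h1 := h.incentive x hx (q y) (h.quality_mem y hy)
  have h3 := h.interimWage_monotoneOn hx hy hxy
  have hx0 : 0 ≤ x := M.a_nonneg.trans hx.1
  rw [← M.c_strictMonoOn.le_iff_le (h.quality_mem x hx) (h.quality_mem y hy)]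
  simp only at h3
  nlinarith

variable [IsMarkovKernel π]

theorem wage_integrable (x : ℝ) : Integrable ω (π x) :=
  Integrable.of_bound h.wage_measurable.aestronglyMeasurable M.b
    (Filter.Eventually.of_forall fun s => by
      rw [Real.norm_eq_abs, abs_of_nonneg (M.a_nonneg.trans (h.wage_mem s).1)]
      exact (h.wage_mem s).2)

theorem mul_real_le_setIntegral {A : Set S} (hA : MeasurableSet A) {t : ℝ}
    (ht : ∀ s ∈ A, t ≤ ω s) (x : ℝ) : t * (π x).real A ≤ ∫ s in A, ω s ∂(π x) := by
  have := setIntegral_mono_on (μ := π x) (f := fun _ => t) (integrable_const t).integrableOn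
    (h.wage_integrable x).integrableOn hA ht
  rwa [setIntegral_const, smul_eq_mul, mul_comm] at this

theorem setIntegral_le_mul_real {A : Set S} (hA : MeasurableSet A) {t : ℝ}
    (ht : ∀ s ∈ A, ω s ≤ t) (x : ℝ) : ∫ s in A, ω s ∂(π x) ≤ t * (π x).real A := by
  have := setIntegral_mono_on (μ := π x) (g := fun _ => t) (h.wage_integrable x).integrableOn
    (integrable_const t).integrableOn hA ht
  rwa [setIntegral_const, smul_eq_mul, mul_comm] at this

theorem setIntegral_intervalIntegrable {A : Set S} (hA : MeasurableSet A) :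
    IntervalIntegrable (fun θ => ∫ s in A, ω s ∂(π (q θ))) volume M.a M.b := by
  refine intervalIntegrable_comp_of_monotoneOn (ψ := fun x => ∫ s in A, ω s ∂(π x)) (B := M.b)
    h.quality_monotoneOn ?_ fun x => ?_
  · simp_rw [← integral_indicator hA]
    exact ((h.wage_measurable.indicator hA).stronglyMeasurable.integral_kernel).measurable
  · have h0 : 0 ≤ ∫ s in A, ω s ∂(π x) :=
      setIntegral_nonneg hA fun s _ => M.a_nonneg.trans (h.wage_mem s).1
    rw [abs_of_nonneg h0]
    refine (h.setIntegral_le_mul_real hA (fun s _ => (h.wage_mem s).2) x).trans ?_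
    exact mul_le_of_le_one_right (M.a_nonneg.trans M.a_lt_b.le) measureReal_le_one

theorem real_intervalIntegrable {A : Set S} (hA : MeasurableSet A) :
    IntervalIntegrable (fun θ => θ * (π (q θ)).real A) volume M.a M.b := by
  refine IntervalIntegrable.continuousOn_mul (intervalIntegrable_comp_of_monotoneOn
    (ψ := fun x => (π x).real A) (B := 1) h.quality_monotoneOn ?_ fun x => ?_) continuousOn_id
  · exact (Kernel.measurable_coe π hA).ennreal_toReal
  · rw [abs_of_nonneg measureReal_nonneg]
    exact measureReal_le_one

theorem interimWage_intervalIntegrable :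
    IntervalIntegrable (fun θ => interimWage π ω (q θ)) volume M.a M.b := by
  simpa [interimWage] using h.setIntegral_intervalIntegrable MeasurableSet.univ

/-- Types below a threshold are on average paid at least their mean. -/
theorem integral_type_le {t : ℝ} (ht : t ∈ Icc M.a M.b) :
    ∫ x in M.a..t, x * M.f x ≤ ∫ x in M.a..t, interimWage π ω (q x) * M.f x := by
  -- Split the scores at wage t. On `A`, Bayes' rule makes wages and types balance; types above t
  -- are paid less than their type there, so types below t are paid at least theirs on average. Off
  -- `A`, wages are at least t, which exceeds every type below t.
  set A : Set S := {s | ω s < t}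
  have hA : MeasurableSet A := measurableSet_lt h.wage_measurable measurable_const
  let d : Set S → ℝ → ℝ := fun B θ =>
    ((∫ s in B, ω s ∂(π (q θ))) - θ * (π (q θ)).real B) * M.f θ
  have hdi : ∀ B, MeasurableSet B → IntervalIntegrable (d B) volume M.a M.b := fun B hB =>
    M.f_mul_intervalIntegrable
      ((h.setIntegral_intervalIntegrable hB).sub (h.real_intervalIntegrable hB))
  have hdA : ∫ θ in M.a..M.b, d A θ = 0 := by
    have h1 := h.bayes A hA
    have h2 : ∫ θ in M.a..M.b, d A θ = (∫ θ in M.a..M.b, (∫ s in A, ω s ∂(π (q θ))) * M.f θ) -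
        ∫ θ in M.a..M.b, θ * (π (q θ)).real A * M.f θ := by
      rw [← intervalIntegral.integral_sub
        (M.f_mul_intervalIntegrable (h.setIntegral_intervalIntegrable hA))
        (M.f_mul_intervalIntegrable (h.real_intervalIntegrable hA))]
      exact intervalIntegral.integral_congr fun θ _ => by simp only [d]; ring
    rw [h2, h1, sub_self]
  have hupper : ∫ θ in t..M.b, d A θ ≤ 0 := by
    rw [← neg_nonneg, ← intervalIntegral.integral_neg]
    refine intervalIntegral.integral_nonneg ht.2 fun θ hθ => ?_
    have h1 := h.setIntegral_le_mul_real hA (t := t) (fun s hs => le_of_lt hs) (q θ)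
    have h2 : t * (π (q θ)).real A ≤ θ * (π (q θ)).real A :=
      mul_le_mul_of_nonneg_right hθ.1 measureReal_nonneg
    have h3 := (M.f_pos θ ⟨ht.1.trans hθ.1, hθ.2⟩).le
    simp only [d, ← neg_mul]
    exact mul_nonneg (by linarith) h3
  have hlower : 0 ≤ ∫ θ in M.a..t, d A θ := by
    have := intervalIntegral.integral_add_adjacent_intervals ((hdi A hA).mono_Icc le_rfl ht.1 ht.2)
      ((hdi A hA).mono_Icc ht.1 ht.2 le_rfl)
    linarith
  have hcompl : 0 ≤ ∫ θ in M.a..t, d Aᶜ θ := by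
    refine intervalIntegral.integral_nonneg ht.1 fun θ hθ => ?_
    have h1 := h.mul_real_le_setIntegral hA.compl (t := t) (fun s hs => not_lt.1 hs) (q θ)
    have h2 : θ * (π (q θ)).real Aᶜ ≤ t * (π (q θ)).real Aᶜ :=
      mul_le_mul_of_nonneg_right hθ.2 measureReal_nonneg
    have h3 := (M.f_pos θ ⟨hθ.1, hθ.2.trans ht.2⟩).le
    exact mul_nonneg (by linarith) h3
  have hsum : ∫ θ in M.a..t, (d A θ + d Aᶜ θ) =
      (∫ x in M.a..t, interimWage π ω (q x) * M.f x) - ∫ x in M.a..t, x * M.f x := by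
    rw [← intervalIntegral.integral_sub
      ((M.f_mul_intervalIntegrable h.interimWage_intervalIntegrable).mono_Icc le_rfl ht.1 ht.2)
      ((M.f_mul_intervalIntegrable (w := fun x => x)
        (continuous_id.intervalIntegrable _ _)).mono_Icc le_rfl ht.1 ht.2)]
    refine intervalIntegral.integral_congr fun θ _ => ?_
    have h1 : (∫ s in A, ω s ∂(π (q θ))) + ∫ s in Aᶜ, ω s ∂(π (q θ)) = interimWage π ω (q θ) :=
      integral_add_compl hA (h.wage_integrable _)
    have h2 : (π (q θ)).real A + (π (q θ)).real Aᶜ = 1 := by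
      rw [measureReal_add_measureReal_compl hA]; simp
    simp only [d]
    linear_combination M.f θ * h1 - θ * M.f θ * h2
  rw [intervalIntegral.integral_add ((hdi A hA).mono_Icc le_rfl ht.1 ht.2)
    ((hdi _ hA.compl).mono_Icc le_rfl ht.1 ht.2)] at hsum
  linarith

/-- The direct mechanism induced by an equilibrium satisfies the principal's constraints. -/
theorem admissible : M.Admissible M.a q (fun θ => interimWage π ω (q θ)) where
  quality_mem := h.quality_mem
  wage_nonneg _ _ := integral_nonneg fun s => M.a_nonneg.trans (h.wage_mem s).1
  wage_integrable := h.interimWage_intervalIntegrable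
  ic_mon := h.quality_monotoneOn
  ic_env := by
    refine ⟨_, envelope_formula M.a_lt_b.le h.interimWage_monotoneOn
      (U := fun θ => θ * interimWage π ω (q θ) - M.c (q θ)) fun x hx y hy => ?_⟩
    have := h.incentive y hy (q x) (h.quality_mem x hx)
    linarith
  ir := h.participation
  mps _ ht := h.integral_type_le ht
  bp := by simpa [interimWage] using h.bayes univ MeasurableSet.univ

end IsEquilibrium

end SignalingModel

end

noncomputable section

namespace SignalingModel

variable (M : SignalingModel)

/-! ### Mechanisms from a wage schedule -/

/-- The cost of quality that goes with the interim wage `w` when the lowest type gets `w0 * a`. -/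
def schemeCost (w0 : ℝ) (w : ℝ → ℝ) (θ : ℝ) : ℝ :=
  θ * w θ - (∫ x in M.a..θ, w x) - w0 * M.a

variable {M} {w0 : ℝ} {w : ℝ → ℝ}

/-- A monotone `w` is a subgradient of its convex primitive. Allowing y on either side of x yields
both upward and downward incentive constraints. -/
theorem mul_sub_le_integral (hw : MonotoneOn w (Icc M.a M.b)) {x y : ℝ}
    (hx : x ∈ Icc M.a M.b) (hy : y ∈ Icc M.a M.b) :
    (y - x) * w x ≤ (∫ z in M.a..y, w z) - ∫ z in M.a..x, w z := by
  have hwi : IntervalIntegrable w volume M.a M.b := by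
    rw [← uIcc_of_le M.a_lt_b.le] at hw
    exact hw.intervalIntegrable
  have hadj : (∫ z in M.a..y, w z) - ∫ z in M.a..x, w z = ∫ z in x..y, w z :=
    intervalIntegral.integral_interval_sub_left (hwi.mono_Icc le_rfl hy.1 hy.2)
      (hwi.mono_Icc le_rfl hx.1 hx.2)
  rw [hadj]
  rcases le_total x y with hxy | hxy
  · have := intervalIntegral.integral_mono_on hxy (intervalIntegrable_const)
      (hwi.mono_Icc hx.1 hxy hy.2) (f := fun _ => w x) fun z hz =>
        hw hx ⟨hx.1.trans hz.1, hz.2.trans hy.2⟩ hz.1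
    simpa using this
  · have := intervalIntegral.integral_mono_on hxy (hwi.mono_Icc hy.1 hxy hx.2)
      (intervalIntegrable_const) (g := fun _ => w x) fun z hz =>
        hw ⟨hy.1.trans hz.1, hz.2.trans hx.2⟩ hx hz.2
    rw [intervalIntegral.integral_symm]
    simp only [intervalIntegral.integral_const, smul_eq_mul] at this
    linarith

theorem schemeCost_incentive (hw : MonotoneOn w (Icc M.a M.b)) {x y : ℝ}
    (hx : x ∈ Icc M.a M.b) (hy : y ∈ Icc M.a M.b) :
    y * w x - M.schemeCost w0 w x ≤ y * w y - M.schemeCost w0 w y := by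
  have := mul_sub_le_integral hw hx hy
  unfold schemeCost
  linarith

theorem schemeCost_strictMonoOn (hw : StrictMonoOn w (Icc M.a M.b)) :
    StrictMonoOn (M.schemeCost w0 w) (Icc M.a M.b) := by
  have key : ∀ x ∈ Icc M.a M.b, ∀ y ∈ Icc M.a M.b, x ≤ y →
      x * (w y - w x) ≤ M.schemeCost w0 w y - M.schemeCost w0 w x := fun x hx y hy _ => by
    have := mul_sub_le_integral hw.monotoneOn hy hx
    unfold schemeCost
    linarith
  intro x hx y hy hxy
  -- If x = 0, `key` between x and y gives only a weak inequality. The intermediate point z is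
  -- positive, so the step from z to y is strict.
  obtain ⟨z, hxz, hzy⟩ := exists_between hxy
  have hz : z ∈ Icc M.a M.b := ⟨hx.1.trans hxz.le, hzy.le.trans hy.2⟩
  have h1 := key x hx z hz hxz.le
  have h2 := key z hz y hy hzy.le
  have h3 : 0 ≤ x * (w z - w x) :=
    mul_nonneg (M.a_nonneg.trans hx.1) (sub_nonneg.2 (hw hx hz hxz).le)
  have h4 : 0 < z * (w y - w z) :=
    mul_pos ((M.a_nonneg.trans hx.1).trans_lt hxz) (sub_pos.2 (hw hz hy hzy))
  linarith

theorem schemeCost_continuousOn (hw : ContinuousOn w (Icc M.a M.b)) :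
    ContinuousOn (M.schemeCost w0 w) (Icc M.a M.b) := by
  have := intervalIntegral.continuousOn_primitive_interval (a := M.a) (b := M.b) (μ := volume)
    (f := w) (by rw [uIcc_of_le M.a_lt_b.le]; exact hw.integrableOn_Icc)
  rw [uIcc_of_le M.a_lt_b.le] at this
  exact ((continuousOn_id.mul hw).sub this).sub continuousOn_const

theorem exists_quality_of_schemeCost (hw : StrictMonoOn w (Icc M.a M.b))
    (ha : 0 ≤ M.schemeCost w0 w M.a) (hb : M.schemeCost w0 w M.b ≤ M.c M.qmax) :
    ∃ q : ℝ → ℝ, (∀ θ ∈ Icc M.a M.b, q θ ∈ Icc 0 M.qmax) ∧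
      ∀ θ ∈ Icc M.a M.b, M.c (q θ) = M.schemeCost w0 w θ := by
  have hm := (schemeCost_strictMonoOn (w0 := w0) hw).monotoneOn
  have key : ∀ θ ∈ Icc M.a M.b, ∃ x ∈ Icc 0 M.qmax, M.c x = M.schemeCost w0 w θ := by
    intro θ hθ
    refine intermediate_value_Icc M.qmax_pos.le M.c_continuousOn ⟨?_, ?_⟩
    · rw [M.c_zero]
      exact ha.trans (hm (left_mem_Icc.2 M.a_lt_b.le) hθ hθ.1)
    · exact (hm hθ (right_mem_Icc.2 M.a_lt_b.le) hθ.2).trans hb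
  choose! q hq using key
  exact ⟨q, fun θ hθ => (hq θ hθ).1, fun θ hθ => (hq θ hθ).2⟩

section Scheme

variable {q : ℝ → ℝ} (hq : ∀ θ ∈ Icc M.a M.b, q θ ∈ Icc 0 M.qmax)
  (hqc : ∀ θ ∈ Icc M.a M.b, M.c (q θ) = M.schemeCost w0 w θ)
include hq hqc

theorem strictMonoOn_of_schemeCost (hw : StrictMonoOn w (Icc M.a M.b)) :
    StrictMonoOn q (Icc M.a M.b) := fun x hx y hy hxy => by
  rw [← M.c_strictMonoOn.lt_iff_lt (hq x hx) (hq y hy), hqc x hx, hqc y hy]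
  exact schemeCost_strictMonoOn hw hx hy hxy

theorem admissible_of_schemeCost (hw0 : w0 ∈ Icc 0 M.a) (hw : StrictMonoOn w (Icc M.a M.b))
    (hwa : w M.a = M.a)
    (hmps : ∀ θ ∈ Icc M.a M.b, ∫ x in M.a..θ, x * M.f x ≤ ∫ x in M.a..θ, w x * M.f x)
    (hbp : ∫ x in M.a..M.b, w x * M.f x = ∫ x in M.a..M.b, x * M.f x) :
    M.Admissible w0 q w where
  quality_mem := hq
  wage_nonneg θ hθ := (hwa ▸ M.a_nonneg).trans
    (hw.monotoneOn (left_mem_Icc.2 M.a_lt_b.le) hθ hθ.1)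
  wage_integrable := by
    have := hw.monotoneOn
    rw [← uIcc_of_le M.a_lt_b.le] at this
    exact this.intervalIntegrable
  ic_mon := (strictMonoOn_of_schemeCost hq hqc hw).monotoneOn
  ic_env := ⟨w0 * M.a, fun θ hθ => by rw [hqc θ hθ]; unfold schemeCost; ring⟩
  ir θ hθ := by
    have h1 := mul_sub_le_integral hw.monotoneOn (left_mem_Icc.2 M.a_lt_b.le) hθ
    rw [intervalIntegral.integral_same, hwa] at h1
    rw [hqc θ hθ]
    unfold schemeCost
    -- The utility of type θ is at least w0 a + a (θ − a), which is at least w0 θ since w0 ≤ a.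
    nlinarith [hw0.2, hθ.1]
  mps := hmps
  bp := hbp

end Scheme

/-! ### Ratings that reveal the type or pool it -/

/-- With probability `p t` the score is `m`, otherwise it is `t`. -/
def poolingKernel {p : ℝ → ℝ} (hp : Measurable p) (m : ℝ) : Kernel ℝ ℝ where
  toFun t := ENNReal.ofReal (1 - p t) • Measure.dirac t + ENNReal.ofReal (p t) • Measure.dirac m
  measurable' := by
    refine Measure.measurable_of_measurable_coe _ fun A hA => ?_
    simp only [Measure.coe_add, Measure.coe_smul, Pi.add_apply, Pi.smul_apply, smul_eq_mul,
      Measure.dirac_apply' _ hA]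
    exact (((measurable_const.sub hp).ennreal_ofReal).mul
      (measurable_one.indicator hA)).add (hp.ennreal_ofReal.mul_const _)

section Pooling

variable {p : ℝ → ℝ} (hp : Measurable p) (m : ℝ)

theorem poolingKernel_apply (t : ℝ) : poolingKernel hp m t =
    ENNReal.ofReal (1 - p t) • Measure.dirac t + ENNReal.ofReal (p t) • Measure.dirac m := rfl

theorem isMarkovKernel_poolingKernel (h01 : ∀ t, p t ∈ Icc 0 1) :
    IsMarkovKernel (poolingKernel hp m) where
  isProbabilityMeasure t := ⟨by
    rw [poolingKernel_apply]
    simp only [Measure.coe_add, Measure.coe_smul, Pi.add_apply, Pi.smul_apply, smul_eq_mul,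
      measure_univ, mul_one]
    rw [← ENNReal.ofReal_add (sub_nonneg.2 (h01 t).2) (h01 t).1]
    simp⟩

theorem integral_poolingKernel (h01 : ∀ t, p t ∈ Icc 0 1) {ψ : ℝ → ℝ} (hψ : Measurable ψ)
    (t : ℝ) : ∫ s, ψ s ∂(poolingKernel hp m t) = (1 - p t) * ψ t + p t * ψ m := by
  have hi : ∀ x : ℝ, Integrable ψ (Measure.dirac x) := fun x =>
    integrable_dirac' hψ.stronglyMeasurable (by simp)
  rw [poolingKernel_apply, integral_add_measure ((hi t).smul_measure ENNReal.ofReal_ne_top)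
    ((hi m).smul_measure ENNReal.ofReal_ne_top), integral_smul_measure, integral_smul_measure,
    integral_dirac, integral_dirac, ENNReal.toReal_ofReal (sub_nonneg.2 (h01 t).2),
    ENNReal.toReal_ofReal (h01 t).1, smul_eq_mul, smul_eq_mul]

end Pooling

/-- The rating decodes a quality x into the highest type τ(x) whose prescribed cost is at most c(x),
then either reveals or pools that type. On path τ inverts `q`. A deviation to x earns the wage of
τ(x) at no less than that type's cost, so it is no better than mimicking τ(x). The pooled score m
may coincide with the revealing score of type m, which is harmless since both carry wage m. -/
theorem exists_rating_of_pooling {p : ℝ → ℝ} (hp : Continuous p) (h01 : ∀ t, p t ∈ Icc 0 1)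
    (hpa : p M.a = 0) {m : ℝ} (hm : m ∈ Icc M.a M.b)
    (hbal : ∫ x in M.a..M.b, p x * (m - x) * M.f x = 0)
    (hw : StrictMonoOn (fun θ => θ + p θ * (m - θ)) (Icc M.a M.b)) {q : ℝ → ℝ}
    (hq : ∀ θ ∈ Icc M.a M.b, q θ ∈ Icc 0 M.qmax)
    (hqc : ∀ θ ∈ Icc M.a M.b,
      M.c (q θ) = M.schemeCost M.a (fun θ => θ + p θ * (m - θ)) θ) :
    ∃ (S : Type) (_ : MeasurableSpace S) (π : Kernel ℝ S) (ω : S → ℝ),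
      IsMarkovKernel π ∧ M.IsEquilibrium π ω q ∧
        ∀ θ ∈ Icc M.a M.b, interimWage π ω (q θ) = θ + p θ * (m - θ) := by
  set w : ℝ → ℝ := fun θ => θ + p θ * (m - θ) with hwdef
  have hab := M.a_lt_b.le
  have haI : M.a ∈ Icc M.a M.b := left_mem_Icc.2 hab
  have hwc : Continuous w := by fun_prop
  have hwa : w M.a = M.a := by simp [hwdef, hpa]
  have hQ := M.qmax_pos.le
  set C := M.schemeCost M.a w with hC
  have hCa : C M.a = 0 := by simp [hC, schemeCost, hwa]
  have hCm : StrictMonoOn C (Icc M.a M.b) := schemeCost_strictMonoOn hw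
  have hCc : ContinuousOn C (Icc M.a M.b) := schemeCost_continuousOn hwc.continuousOn
  -- the highest type whose cost is affordable
  let T : ℝ → Set ℝ := fun x => {θ | θ ∈ Icc M.a M.b ∧ C θ ≤ M.c (projIcc 0 M.qmax hQ x)}
  let τ : ℝ → ℝ := fun x => sSup (T x)
  have hTa : ∀ x, M.a ∈ T x := fun x => ⟨haI, by rw [hCa]; exact M.c_nonneg (Subtype.prop _)⟩
  have hTbdd : ∀ x, BddAbove (T x) := fun x => ⟨M.b, fun θ hθ => hθ.1.2⟩
  have hTclosed : ∀ x, IsClosed (T x) := fun x =>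
    hCc.preimage_isClosed_of_isClosed isClosed_Icc isClosed_Iic
  have hτmem : ∀ x, τ x ∈ T x := fun x => (hTclosed x).csSup_mem ⟨_, hTa x⟩ (hTbdd x)
  have hτm : Monotone τ := fun x y hxy => csSup_le_csSup (hTbdd y) ⟨_, hTa x⟩ fun θ hθ =>
    ⟨hθ.1, hθ.2.trans (M.c_strictMonoOn.monotoneOn (Subtype.prop _) (Subtype.prop _)
      (monotone_projIcc hQ hxy))⟩
  have hτq : ∀ θ ∈ Icc M.a M.b, τ (q θ) = θ := fun θ hθ => by
    have : T (q θ) = Icc M.a θ := by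
      ext x
      simp only [T, mem_ofPred_eq, projIcc_of_mem hQ (hq θ hθ), hqc θ hθ]
      constructor
      · rintro ⟨h1, h2⟩; exact ⟨h1.1, (hCm.le_iff_le h1 hθ).1 h2⟩
      · rintro ⟨h1, h2⟩
        have hx : x ∈ Icc M.a M.b := ⟨h1, h2.trans hθ.2⟩
        exact ⟨hx, (hCm.le_iff_le hx hθ).2 h2⟩
    simp only [τ, this]
    exact csSup_Icc hθ.1
  let ω : ℝ → ℝ := fun s => projIcc M.a M.b hab s
  have hωm : Measurable ω := (continuous_subtype_val.comp continuous_projIcc).measurable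
  have hωe : ∀ s ∈ Icc M.a M.b, ω s = s := fun s hs => by simp only [ω, projIcc_of_mem hab hs]
  let κ := poolingKernel hp.measurable m
  have hκ : IsMarkovKernel κ := isMarkovKernel_poolingKernel hp.measurable m h01
  let π : Kernel ℝ ℝ := κ.comap τ hτm.measurable
  have hπ : IsMarkovKernel π := inferInstance
  have hπi : ∀ ψ : ℝ → ℝ, Measurable ψ → ∀ x,
      ∫ s, ψ s ∂(π x) = (1 - p (τ x)) * ψ (τ x) + p (τ x) * ψ m := fun ψ hψ x => by
    simp only [π, Kernel.comap_apply]
    exact integral_poolingKernel hp.measurable m h01 hψ (τ x)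
  have hint : ∀ x, interimWage π ω x = w (τ x) := fun x => by
    rw [interimWage, hπi ω hωm, hωe _ (hτmem x).1, hωe m hm]
    simp only [hwdef]
    ring
  have hintq : ∀ θ ∈ Icc M.a M.b, interimWage π ω (q θ) = w θ := fun θ hθ => by
    rw [hint, hτq θ hθ]
  refine ⟨ℝ, inferInstance, π, ω, hπ, ⟨hωm, fun s => Subtype.prop _, hq, ?_, ?_, ?_⟩, hintq⟩
  · intro A hA
    have h1 : ∀ θ ∈ Icc M.a M.b, ∫ s in A, ω s ∂(π (q θ)) =
        A.indicator (fun x => (1 - p x) * x) θ + p θ * A.indicator (fun x => x) m :=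
      fun θ hθ => by
        rw [← integral_indicator hA, hπi _ (hωm.indicator hA), hτq θ hθ]
        simp only [indicator]
        split_ifs <;> simp [hωe θ hθ, hωe m hm]
    have h2 : ∀ θ ∈ Icc M.a M.b, (π (q θ)).real A =
        A.indicator (fun x => (1 - p x)) θ + p θ * A.indicator (fun _ => 1) m :=
      fun θ hθ => by
        have : (π (q θ)).real A = ∫ s, A.indicator (fun _ => (1 : ℝ)) s ∂(π (q θ)) := by
          rw [integral_indicator hA]; simp
        rw [this, hπi _ (measurable_const.indicator hA), hτq θ hθ]
        simp only [indicator]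
        split_ifs <;> simp
    have hX : IntervalIntegrable (fun θ => (∫ s in A, ω s ∂(π (q θ))) * M.f θ)
        volume M.a M.b := by
      refine M.f_mul_intervalIntegrable ?_
      rw [intervalIntegrable_iff_integrableOn_Icc_of_le hab]
      have hc1 : Continuous fun x : ℝ => (1 - p x) * x := by fun_prop
      have hc2 : Continuous fun x : ℝ => p x * A.indicator (fun x => x) m := by fun_prop
      refine (((hc1.continuousOn.integrableOn_Icc).indicator hA).add
        hc2.continuousOn.integrableOn_Icc).congr ?_
      filter_upwards [ae_restrict_mem measurableSet_Icc] with θ hθ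
      rw [h1 θ hθ]; rfl
    have hY : IntervalIntegrable (fun θ => A.indicator (fun _ => (1 : ℝ)) m *
        (p θ * (m - θ) * M.f θ)) volume M.a M.b := by
      have hc : Continuous fun θ : ℝ => p θ * (m - θ) := by fun_prop
      exact (M.f_mul_intervalIntegrable (hc.intervalIntegrable _ _)).const_mul _
    -- Revealed types contribute equally to both sides of Bayes' rule. The difference is the pooled
    -- part p(θ)(m − θ), present only if m lies in `A`, and `hbal` integrates it to zero.
    have h3 : ∫ θ in M.a..M.b, θ * (π (q θ)).real A * M.f θ =
        ∫ θ in M.a..M.b, ((∫ s in A, ω s ∂(π (q θ))) * M.f θ -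
          A.indicator (fun _ => (1 : ℝ)) m * (p θ * (m - θ) * M.f θ)) := by
      refine intervalIntegral.integral_congr fun θ hθ => ?_
      rw [uIcc_of_le hab] at hθ
      rw [h1 θ hθ, h2 θ hθ]
      simp only [indicator]
      split_ifs <;> ring
    rw [h3, intervalIntegral.integral_sub hX hY, intervalIntegral.integral_const_mul, hbal]
    ring
  · intro θ hθ x hx
    have h1 := (hτmem x)
    have h2 : C (τ x) ≤ M.c x := by
      have := h1.2
      rwa [projIcc_of_mem hQ hx] at this
    have h3 := schemeCost_incentive (w0 := M.a) hw.monotoneOn h1.1 hθ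
    rw [hint, hintq θ hθ, hqc θ hθ]
    simp only [← hC] at h3 ⊢
    linarith
  · intro θ hθ
    have h1 := schemeCost_incentive (w0 := M.a) hw.monotoneOn haI hθ
    rw [hintq θ hθ, hqc θ hθ]
    simp only [← hC] at h1 ⊢
    rw [hwa, hCa] at h1
    linarith

end SignalingModel

end

noncomputable section

open Filter Topology

namespace SignalingModel

variable {M : SignalingModel} {w0 : ℝ} {qf : ℝ → ℝ}

/-! ### First-order gain from a small change of the wage schedule -/

theorem abs_v_sub_le {L : ℝ} (hL : ∀ q ∈ Icc 0 M.qmax, ∀ θ ∈ Icc M.a M.b, |M.vq q θ| ≤ L)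
    {x y θ : ℝ} (hx : x ∈ Icc 0 M.qmax) (hy : y ∈ Icc 0 M.qmax) (hθ : θ ∈ Icc M.a M.b) :
    |M.v y θ - M.v x θ| ≤ L * |y - x| := by
  have h1 := M.v_tangent hθ hx hy
  have h2 := M.v_tangent hθ hy hx
  have h3 : |M.vq x θ * (y - x)| ≤ L * |y - x| := by
    rw [abs_mul]; exact mul_le_mul_of_nonneg_right (hL x hx θ hθ) (abs_nonneg _)
  have h4 : |M.vq y θ * (x - y)| ≤ L * |y - x| := by
    rw [abs_mul, abs_sub_comm x y]
    exact mul_le_mul_of_nonneg_right (hL y hy θ hθ) (abs_nonneg _)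
  rw [abs_le] at h3 h4 ⊢
  constructor <;> linarith

theorem c'_mul_abs_sub_le {k x y : ℝ} (hx : x ∈ Icc 0 M.qmax) (hy : y ∈ Icc 0 M.qmax)
    (hkx : k ≤ M.c' x) (hky : k ≤ M.c' y) : k * |y - x| ≤ |M.c y - M.c x| := by
  have h1 := M.c_tangent hx hy
  have h2 := M.c_tangent hy hx
  rcases le_total x y with hxy | hxy
  · rw [abs_of_nonneg (sub_nonneg.2 hxy)]
    refine le_trans ?_ (le_abs_self _)
    nlinarith
  · rw [abs_of_nonpos (sub_nonpos.2 hxy)]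
    refine le_trans ?_ (neg_le_abs _)
    nlinarith

/-- If quality costs move by `ε E`, the payoff of type `θ` moves by `ε v_q E / c'`. -/
theorem tendsto_v_difference_quotient {x θ E : ℝ} (hθ : θ ∈ Icc M.a M.b)
    (hx : x ∈ Icc 0 M.qmax) (hcx : 0 < M.c' x) {q : ℝ → ℝ}
    (hq : ∀ᶠ ε in 𝓝[>] (0 : ℝ), q ε ∈ Icc 0 M.qmax)
    (hqc : ∀ᶠ ε in 𝓝[>] (0 : ℝ), M.c (q ε) = M.c x + ε * E)
    (hlim : Tendsto q (𝓝[>] 0) (𝓝 x)) :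
    Tendsto (fun ε => (M.v (q ε) θ - M.v x θ) / ε) (𝓝[>] 0) (𝓝 (M.vq x θ / M.c' x * E)) := by
  have hlim' : Tendsto q (𝓝[>] 0) (𝓝[Icc 0 M.qmax] x) :=
    tendsto_nhdsWithin_iff.2 ⟨hlim, hq⟩
  have hc : Tendsto (fun ε => M.c' (q ε)) (𝓝[>] 0) (𝓝 (M.c' x)) :=
    (M.c'_continuousOn x hx).tendsto.comp hlim'
  have hvc : ContinuousWithinAt (fun y => M.vq y θ) (Icc 0 M.qmax) x :=
    (M.vq_continuousOn (x, θ) ⟨hx, hθ⟩).comp (f := fun y : ℝ => (y, θ))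
      (by fun_prop) (fun y hy => ⟨hy, hθ⟩)
  have hv : Tendsto (fun ε => M.vq (q ε) θ) (𝓝[>] 0) (𝓝 (M.vq x θ)) := hvc.tendsto.comp hlim'
  have hcpos : ∀ᶠ ε in 𝓝[>] (0 : ℝ), 0 < M.c' (q ε) := hc.eventually_const_lt hcx
  -- Tangents of c at the old and at the new quality squeeze the quotient between E / c'(q ε) and E
  -- / c'(x). No inverse of c is needed, and end points of Q are covered. Tangents of v are used the
  -- same way below.
  have hr : Tendsto (fun ε => (q ε - x) / ε) (𝓝[>] 0) (𝓝 (E / M.c' x)) := by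
    refine tendsto_of_tendsto_of_tendsto_of_le_of_le' (tendsto_const_nhds.div hc hcx.ne')
      tendsto_const_nhds ?_ ?_
    · filter_upwards [hq, hqc, hcpos, self_mem_nhdsWithin] with ε h1 h2 h3 h4
      have h4 : 0 < ε := h4
      change E / M.c' (q ε) ≤ (q ε - x) / ε
      have h5 := M.c_tangent h1 hx
      rw [div_le_div_iff₀ h3 h4]
      linarith
    · filter_upwards [hq, hqc, self_mem_nhdsWithin] with ε h1 h2 h4
      have h4 : 0 < ε := h4
      have h5 := M.c_tangent hx h1
      rw [div_le_div_iff₀ h4 hcx]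
      linarith
  have hlow := hv.mul hr
  have hup := (tendsto_const_nhds (x := M.vq x θ)).mul hr
  have heq : M.vq x θ / M.c' x * E = M.vq x θ * (E / M.c' x) := by ring
  rw [heq]
  refine tendsto_of_tendsto_of_tendsto_of_le_of_le' hlow hup ?_ ?_
  · filter_upwards [hq, self_mem_nhdsWithin] with ε h1 h4
    have h4 : 0 < ε := h4
    have h5 := M.v_tangent hθ h1 hx
    rw [← mul_div_assoc]
    exact div_le_div_of_nonneg_right (by linarith) h4.le
  · filter_upwards [hq, self_mem_nhdsWithin] with ε h1 h4
    have h4 : 0 < ε := h4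
    have h5 := M.v_tangent hθ hx h1
    rw [← mul_div_assoc]
    exact div_le_div_of_nonneg_right (by linarith) h4.le

/-- Below s nothing changes, since `D` vanishes there. Above s both schemes are monotone and start
from qf(s), so c' is at least c'(qf(s)) > 0 along both and qualities move by at most a multiple of
ε. Dominated convergence then identifies the derivative of the payoff at ε = 0 as ∫ J D dF. -/
theorem IsFullSeparationQuality.eventually_payoff_lt (h : M.IsFullSeparationQuality w0 qf)
    {s : ℝ} (hs : s ∈ Ioo M.a M.b) {D : ℝ → ℝ} (hDc : Continuous D)
    (hD0 : ∀ x ≤ s, D x = 0) (hpos : 0 < ∫ x in s..M.b, M.J qf x * (D x * M.f x))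
    {q : ℝ → ℝ → ℝ}
    (hq : ∀ᶠ ε in 𝓝[>] (0 : ℝ), ∀ θ ∈ Icc M.a M.b, q ε θ ∈ Icc 0 M.qmax)
    (hqm : ∀ᶠ ε in 𝓝[>] (0 : ℝ), MonotoneOn (q ε) (Icc M.a M.b))
    (hqc : ∀ᶠ ε in 𝓝[>] (0 : ℝ), ∀ θ ∈ Icc M.a M.b,
      M.c (q ε θ) = M.c (qf θ) + ε * (θ * D θ - ∫ x in M.a..θ, D x)) :
    ∀ᶠ ε in 𝓝[>] (0 : ℝ), M.payoff qf < M.payoff (q ε) := by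
  set E : ℝ → ℝ := fun θ => θ * D θ - ∫ x in M.a..θ, D x with hE
  change ∀ᶠ ε in 𝓝[>] (0 : ℝ), ∀ θ ∈ Icc M.a M.b, M.c (q ε θ) = M.c (qf θ) + ε * E θ at hqc
  have hsub : Icc s M.b ⊆ Ioc M.a M.b := fun x hx => ⟨hs.1.trans_le hx.1, hx.2⟩
  have hsI := Ioo_subset_Icc_self hs
  have hEc : Continuous E :=
    (continuous_id.mul hDc).sub (intervalIntegral.continuous_primitive
      (fun a b => hDc.intervalIntegrable a b) M.a)
  have hint0 : ∀ x ∈ Icc M.a s, ∫ y in M.a..x, D y = 0 := fun x hx => by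
    rw [intervalIntegral.integral_congr (g := fun _ => 0) fun y hy => ?_]
    · simp
    · rw [uIcc_of_le hx.1] at hy
      exact hD0 y (hy.2.trans hx.2)
  have hE0 : ∀ x ∈ Icc M.a s, E x = 0 := fun x hx => by
    simp only [hE, hint0 x hx, hD0 x hx.2, mul_zero, sub_zero]
  obtain ⟨L, hL0, hL⟩ := M.exists_vq_bound
  obtain ⟨B, hB0, hB⟩ := M.exists_f_bound
  obtain ⟨N, hN⟩ := (isCompact_Icc (a := s) (b := M.b)).exists_bound_of_continuousOn
    hEc.continuousOn
  set k := M.c' (qf s) with hk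
  have hk0 : 0 < k := h.c'_pos (Ioo_subset_Ioc_self hs)
  have hkf : ∀ θ ∈ Icc s M.b, k ≤ M.c' (qf θ) := fun θ hθ =>
    M.c'_mono (h.mem_Icc hsI) (h.mem_Icc (Ioc_subset_Icc_self (hsub hθ)))
      (h.strictMonoOn.monotoneOn hsI (Ioc_subset_Icc_self (hsub hθ)) hθ.1)
  have hsame : ∀ᶠ ε in 𝓝[>] (0 : ℝ), ∀ θ ∈ Icc M.a s, q ε θ = qf θ := by
    filter_upwards [hq, hqc] with ε h1 h2 θ hθ
    have hθI : θ ∈ Icc M.a M.b := ⟨hθ.1, hθ.2.trans hs.2.le⟩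
    refine M.c_strictMonoOn.injOn (h1 θ hθI) (h.mem_Icc hθI) ?_
    rw [h2 θ hθI, hE0 θ hθ]; ring
  have hdist : ∀ᶠ ε in 𝓝[>] (0 : ℝ), ∀ θ ∈ Icc s M.b, |q ε θ - qf θ| ≤ ε * (N / k) := by
    filter_upwards [hq, hqc, hqm, hsame, self_mem_nhdsWithin] with ε h1 h2 h3 h4 hε θ hθ
    have hε : 0 < ε := hε
    have hθI : θ ∈ Icc M.a M.b := Ioc_subset_Icc_self (hsub hθ)
    have h5 : k ≤ M.c' (q ε θ) := by
      rw [hk, ← h4 s ⟨hs.1.le, le_rfl⟩]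
      exact M.c'_mono (h1 s hsI) (h1 θ hθI) (h3 hsI hθI hθ.1)
    have h6 := c'_mul_abs_sub_le (h.mem_Icc hθI) (h1 θ hθI) (hkf θ hθ) h5
    rw [h2 θ hθI, add_sub_cancel_left, abs_mul, abs_of_pos hε] at h6
    have h7 : ε * |E θ| ≤ ε * N := mul_le_mul_of_nonneg_left (hN θ hθ) hε.le
    rw [← mul_div_assoc, le_div_iff₀ hk0]
    linarith
  have hlim : ∀ θ ∈ Icc s M.b, Tendsto (fun ε => q ε θ) (𝓝[>] 0) (𝓝 (qf θ)) := fun θ hθ => by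
    have h1 : Tendsto (fun ε : ℝ => ε * (N / k)) (𝓝[>] 0) (𝓝 0) := by
      have : Tendsto (fun ε : ℝ => ε * (N / k)) (𝓝 0) (𝓝 (0 * (N / k))) :=
        (continuous_id.mul continuous_const).tendsto 0
      rw [zero_mul] at this
      exact this.mono_left nhdsWithin_le_nhds
    rw [tendsto_iff_dist_tendsto_zero]
    refine squeeze_zero' (Eventually.of_forall fun _ => dist_nonneg) ?_ h1
    filter_upwards [hdist] with ε hε
    rw [Real.dist_eq]
    exact hε θ hθ
  have hqfi := M.payoff_integrable (fun _ => h.mem_Icc) h.strictMonoOn.monotoneOn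
  have hDCT : Tendsto (fun ε => ∫ θ in s..M.b, (M.v (q ε θ) θ - M.v (qf θ) θ) / ε * M.f θ)
      (𝓝[>] 0) (𝓝 (∫ θ in s..M.b, M.vq (qf θ) θ / M.c' (qf θ) * E θ * M.f θ)) := by
    refine intervalIntegral.tendsto_integral_filter_of_dominated_convergence
      (fun _ => L * (N / k) * B) ?_ ?_ intervalIntegrable_const ?_
    · filter_upwards [hq, hqm] with ε h1 h2
      have h3 := (((M.payoff_integrable h1 h2).sub hqfi).div_const ε).mono_Icc hs.1.le hs.2.le
        le_rfl
      refine h3.def'.aestronglyMeasurable.congr (Eventually.of_forall fun θ => ?_)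
      simp only
      ring
    · filter_upwards [hq, hdist, self_mem_nhdsWithin] with ε h1 h2 hε
      have hε : 0 < ε := hε
      refine Eventually.of_forall fun θ hθ => ?_
      rw [uIoc_of_le hs.2.le] at hθ
      have hθ' := Ioc_subset_Icc_self hθ
      have hθI : θ ∈ Icc M.a M.b := Ioc_subset_Icc_self (hsub hθ')
      have h3 := abs_v_sub_le hL (h.mem_Icc hθI) (h1 θ hθI) hθI
      have h4 : |(M.v (q ε θ) θ - M.v (qf θ) θ) / ε| ≤ L * (N / k) := by
        rw [abs_div, abs_of_pos hε, div_le_iff₀ hε]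
        calc _ ≤ L * |q ε θ - qf θ| := h3
          _ ≤ L * (ε * (N / k)) := mul_le_mul_of_nonneg_left (h2 θ hθ') hL0
          _ = _ := by ring
      rw [norm_mul, Real.norm_eq_abs, Real.norm_eq_abs]
      exact mul_le_mul h4 (hB θ hθI) (abs_nonneg _) ((abs_nonneg _).trans h4)
    · refine Eventually.of_forall fun θ hθ => ?_
      rw [uIoc_of_le hs.2.le] at hθ
      have hθ' := Ioc_subset_Icc_self hθ
      have hθI : θ ∈ Icc M.a M.b := Ioc_subset_Icc_self (hsub hθ')
      exact (tendsto_v_difference_quotient hθI (h.mem_Icc hθI) (h.c'_pos (hsub hθ'))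
        (hq.mono fun ε h1 => h1 θ hθI) (hqc.mono fun ε h1 => h1 θ hθI) (hlim θ hθ')).mul_const _
  have hval : ∫ θ in s..M.b, M.vq (qf θ) θ / M.c' (qf θ) * E θ * M.f θ =
      ∫ x in s..M.b, M.J qf x * (D x * M.f x) := by
    rw [← h.integral_weight_mul hs (hDc.intervalIntegrable _ _)]
    refine intervalIntegral.integral_congr fun θ hθ => ?_
    have : ∫ x in M.a..θ, D x = ∫ x in s..θ, D x := by
      rw [← intervalIntegral.integral_add_adjacent_intervals (hDc.intervalIntegrable M.a s)
        (hDc.intervalIntegrable s θ), hint0 s ⟨hs.1.le, le_rfl⟩, zero_add]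
    simp only [hE, weight, this]
    ring
  rw [hval] at hDCT
  filter_upwards [hDCT.eventually_const_lt hpos, hq, hqm, hsame, self_mem_nhdsWithin]
    with ε h1 h2 h3 h4 hε
  have hε : 0 < ε := hε
  have hqi := M.payoff_integrable h2 h3
  have h5 : M.payoff (q ε) - M.payoff qf =
      ε * ∫ θ in s..M.b, (M.v (q ε θ) θ - M.v (qf θ) θ) / ε * M.f θ := by
    unfold payoff
    rw [← intervalIntegral.integral_sub hqi hqfi, ← intervalIntegral.integral_const_mul,
      ← intervalIntegral.integral_add_adjacent_intervals
        ((hqi.sub hqfi).mono_Icc le_rfl hs.1.le hs.2.le)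
        ((hqi.sub hqfi).mono_Icc hs.1.le hs.2.le le_rfl)]
    have h6 : ∫ θ in M.a..s, (M.v (q ε θ) θ * M.f θ - M.v (qf θ) θ * M.f θ) = 0 := by
      rw [intervalIntegral.integral_congr (g := fun _ => 0) fun θ hθ => ?_]
      · simp
      · rw [uIcc_of_le hs.1.le] at hθ
        simp only
        rw [h4 θ hθ, sub_self]
    rw [h6, zero_add]
    refine intervalIntegral.integral_congr fun θ _ => ?_
    field_simp
  have := mul_pos hε h1
  linarith

end SignalingModel

end

noncomputable section

open Filter Topology

namespace SignalingModel

variable {M : SignalingModel} {w0 : ℝ} {qf : ℝ → ℝ}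

/-! ### Pooling a little probability around two types -/

/-- The tent of height and radius `r` around `z`. -/
def tent (r z x : ℝ) : ℝ := max 0 (r - |x - z|)

theorem tent_continuous (r z : ℝ) : Continuous (tent r z) := by unfold tent; fun_prop

theorem tent_nonneg (r z x : ℝ) : 0 ≤ tent r z x := le_max_left _ _

theorem tent_le {r : ℝ} (hr : 0 ≤ r) (z x : ℝ) : tent r z x ≤ r :=
  max_le hr (by linarith [abs_nonneg (x - z)])

theorem tent_self {r : ℝ} (hr : 0 ≤ r) (z : ℝ) : tent r z z = r := by simp [tent, hr]

theorem tent_eq_zero {r z x : ℝ} (h : r ≤ |x - z|) : tent r z x = 0 :=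
  max_eq_left (by linarith)

theorem abs_tent_sub_le (r z x y : ℝ) : |tent r z y - tent r z x| ≤ |y - x| := by
  unfold tent
  rw [max_comm 0, max_comm 0]
  refine (abs_max_sub_max_le_abs _ _ _).trans ?_
  rw [sub_sub_sub_cancel_left, abs_sub_comm y x]
  refine (abs_abs_sub_abs_le_abs_sub _ _).trans ?_
  rw [sub_sub_sub_cancel_right]

theorem integral_tent_mul_pos {r z : ℝ} (hr : 0 < r) (hz : z ∈ Icc M.a M.b) {g : ℝ → ℝ}
    (hg : ContinuousOn g (Icc M.a M.b)) (hg0 : ∀ x ∈ Icc M.a M.b, |x - z| < r → 0 < g x) :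
    0 < ∫ x in M.a..M.b, tent r z x * g x := by
  refine intervalIntegral.integral_pos M.a_lt_b ((tent_continuous r z).continuousOn.mul hg)
    (fun x hx => ?_) ⟨z, hz, ?_⟩
  · rcases lt_or_ge |x - z| r with h | h
    · exact mul_nonneg (tent_nonneg _ _ _) (hg0 x (Ioc_subset_Icc_self hx) h).le
    · rw [tent_eq_zero h, zero_mul]
  · rw [tent_self hr.le]
    exact mul_pos hr (hg0 z hz (by simpa using hr))

/-- `φ` gives relative pooling probabilities around two types z₁ < z₂ with J(z₁) > J(z₂), and m is
the pooled posterior mean. Vanishing below s > a keeps the variation away from the lowest type. `Λ`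
bounds `φ` and the rate at which the wage change can fall, so for ε Λ < 1 the probabilities are
valid and wages stay increasing. -/
theorem IsFullSeparationQuality.exists_pooling (h : M.IsFullSeparationQuality w0 qf)
    (hJ : ¬ MonotoneOn (M.J qf) (Ioc M.a M.b)) :
    ∃ (φ : ℝ → ℝ) (m s Λ : ℝ), Continuous φ ∧ (∀ x, 0 ≤ φ x) ∧ (∀ x, φ x ≤ Λ) ∧
      m ∈ Icc M.a M.b ∧ s ∈ Ioo M.a M.b ∧ (∀ x ≤ s, φ x = 0) ∧
      ∫ x in M.a..M.b, φ x * (m - x) * M.f x = 0 ∧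
      0 < ∫ x in s..M.b, M.J qf x * (φ x * (m - x) * M.f x) ∧
      ∀ x ∈ Icc M.a M.b, ∀ y ∈ Icc M.a M.b, x < y →
        φ x * (m - x) - φ y * (m - y) ≤ Λ * (y - x) := by
  simp only [MonotoneOn, not_forall, not_le] at hJ
  obtain ⟨z₁, hz₁, z₂, hz₂, hz, hJz⟩ := hJ
  have hz : z₁ < z₂ := hz.lt_of_ne (by rintro rfl; exact lt_irrefl _ hJz)
  obtain ⟨α, hα₂, hα₁⟩ := exists_between hJz
  have hJc := h.J_continuousOn
  obtain ⟨r₁, hr₁, h1⟩ := Metric.mem_nhdsWithin_iff.1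
    ((hJc z₁ hz₁).tendsto.eventually_const_lt hα₁)
  obtain ⟨r₂, hr₂, h2⟩ := Metric.mem_nhdsWithin_iff.1
    ((hJc z₂ hz₂).tendsto.eventually_lt_const hα₂)
  set m := (z₁ + z₂) / 2 with hm
  -- The tents must fit where J is above, respectively below, α, must lie on opposite sides of m,
  -- and must stay clear of a.
  obtain ⟨r, hr0, hr⟩ : ∃ r, 0 < r ∧ r < min (min r₁ r₂) (min ((z₂ - z₁) / 2) (z₁ - M.a)) :=
    exists_between (lt_min (lt_min hr₁ hr₂) (lt_min (by linarith) (by linarith [hz₁.1])))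
  simp only [lt_min_iff] at hr
  obtain ⟨⟨hrr₁, hrr₂⟩, hrm, hra⟩ := hr
  have hz₁I := Ioc_subset_Icc_self hz₁
  have hz₂I := Ioc_subset_Icc_self hz₂
  set A₁ := ∫ x in M.a..M.b, tent r z₁ x * ((m - x) * M.f x) with hA₁
  set A₂ := ∫ x in M.a..M.b, tent r z₂ x * ((x - m) * M.f x) with hA₂
  have hg₁ : ContinuousOn (fun x => (m - x) * M.f x) (Icc M.a M.b) :=
    (by fun_prop : Continuous fun x : ℝ => m - x).continuousOn.mul M.f_cont
  have hg₂ : ContinuousOn (fun x => (x - m) * M.f x) (Icc M.a M.b) :=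
    (by fun_prop : Continuous fun x : ℝ => x - m).continuousOn.mul M.f_cont
  have hA₁0 : 0 < A₁ := integral_tent_mul_pos hr0 hz₁I hg₁ fun x hx hxz =>
    mul_pos (by linarith [(abs_lt.1 hxz).2]) (M.f_pos x hx)
  have hA₂0 : 0 < A₂ := integral_tent_mul_pos hr0 hz₂I hg₂ fun x hx hxz =>
    mul_pos (by linarith [(abs_lt.1 hxz).1]) (M.f_pos x hx)
  have hu := uIcc_of_le M.a_lt_b.le
  have hi₁ : IntervalIntegrable (fun x => tent r z₁ x * ((m - x) * M.f x)) volume M.a M.b :=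
    ContinuousOn.intervalIntegrable (by
      rw [hu]; exact (tent_continuous _ _).continuousOn.mul hg₁)
  have hi₂ : IntervalIntegrable (fun x => tent r z₂ x * ((x - m) * M.f x)) volume M.a M.b :=
    ContinuousOn.intervalIntegrable (by
      rw [hu]; exact (tent_continuous _ _).continuousOn.mul hg₂)
  -- Crossing the weights `A₂` and `A₁` equalizes the two deviations from m, so that the posterior
  -- mean after the pooled score is exactly m.
  let φ : ℝ → ℝ := fun x => A₂ * tent r z₁ x + A₁ * tent r z₂ x
  have hφc : Continuous φ :=
    ((tent_continuous r z₁).const_mul A₂).add ((tent_continuous r z₂).const_mul A₁)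
  have hφ0 : ∀ x, 0 ≤ φ x := fun x =>
    add_nonneg (mul_nonneg hA₂0.le (tent_nonneg _ _ _)) (mul_nonneg hA₁0.le (tent_nonneg _ _ _))
  have hφr : ∀ x, φ x ≤ (A₂ + A₁) * r := fun x => by
    rw [add_mul]
    exact add_le_add (mul_le_mul_of_nonneg_left (tent_le hr0.le _ _) hA₂0.le)
      (mul_le_mul_of_nonneg_left (tent_le hr0.le _ _) hA₁0.le)
  have hφL : ∀ x y, |φ y - φ x| ≤ (A₂ + A₁) * |y - x| := fun x y => by
    have h3 : φ y - φ x = A₂ * (tent r z₁ y - tent r z₁ x) + A₁ * (tent r z₂ y - tent r z₂ x) := by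
      simp only [φ]; ring
    rw [h3, add_mul]
    refine (abs_add_le _ _).trans (add_le_add ?_ ?_)
    · rw [abs_mul, abs_of_pos hA₂0]
      exact mul_le_mul_of_nonneg_left (abs_tent_sub_le _ _ _ _) hA₂0.le
    · rw [abs_mul, abs_of_pos hA₁0]
      exact mul_le_mul_of_nonneg_left (abs_tent_sub_le _ _ _ _) hA₁0.le
  have hmI : m ∈ Icc M.a M.b := ⟨by linarith [hz₁I.1, hz₂I.1], by linarith [hz₁I.2, hz₂I.2]⟩
  have hφs : ∀ x ≤ z₁ - r, φ x = 0 := fun x hx => by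
    have h3 : tent r z₁ x = 0 := tent_eq_zero (le_abs.2 (Or.inr (by linarith)))
    have h4 : tent r z₂ x = 0 := tent_eq_zero (le_abs.2 (Or.inr (by linarith)))
    simp [φ, h3, h4]
  have hsI : z₁ - r ∈ Ioo M.a M.b := ⟨by linarith, by linarith [hz₁.2]⟩
  have hbal : ∫ x in M.a..M.b, φ x * (m - x) * M.f x = 0 := by
    have : ∫ x in M.a..M.b, φ x * (m - x) * M.f x = A₂ * A₁ - A₁ * A₂ := by
      rw [hA₁, ← intervalIntegral.integral_const_mul, ← hA₁, hA₂,
        ← intervalIntegral.integral_const_mul, ← hA₂,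
        ← intervalIntegral.integral_sub (hi₁.const_mul _) (hi₂.const_mul _)]
      exact intervalIntegral.integral_congr fun x _ => by simp only [φ]; ring
    rw [this]; ring
  have hsub : Icc (z₁ - r) M.b ⊆ Ioc M.a M.b := fun x hx => ⟨hsI.1.trans_le hx.1, hx.2⟩
  have hdc : ContinuousOn (fun x => φ x * (m - x) * M.f x) (Icc M.a M.b) :=
    (by fun_prop : Continuous fun x : ℝ => φ x * (m - x)).continuousOn.mul M.f_cont
  have hdi : IntervalIntegrable (fun x => φ x * (m - x) * M.f x) volume M.a M.b :=
    ContinuousOn.intervalIntegrable (by rw [hu]; exact hdc)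
  have hJs : ContinuousOn (M.J qf) (Icc (z₁ - r) M.b) := hJc.mono hsub
  have hus := uIcc_of_le hsI.2.le
  have hbal' : ∫ x in (z₁ - r)..M.b, φ x * (m - x) * M.f x = 0 := by
    rw [← intervalIntegral.integral_add_adjacent_intervals
      (hdi.mono_Icc le_rfl hsI.1.le hsI.2.le) (hdi.mono_Icc hsI.1.le hsI.2.le le_rfl)] at hbal
    rw [intervalIntegral.integral_congr (a := M.a) (b := z₁ - r) (g := fun _ => 0)
      fun x hx => ?_] at hbal
    · simpa using hbal
    · rw [uIcc_of_le hsI.1.le] at hx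
      simp only
      rw [hφs x hx.2]; ring
  -- Subtracting α costs nothing by `hbal'`. Then J − α and m − x have the same sign on each tent:
  -- both positive near z₁, both negative near z₂.
  have hpos : 0 < ∫ x in (z₁ - r)..M.b, (M.J qf x - α) * (φ x * (m - x) * M.f x) := by
    refine intervalIntegral.integral_pos hsI.2
      ((hJs.sub continuousOn_const).mul (hdc.mono (Icc_subset_Icc_left hsI.1.le)))
      (fun x hx => ?_) ⟨z₁, ⟨by linarith, hz₁.2⟩, ?_⟩
    · have hx' := hsub (Ioc_subset_Icc_self hx)
      have hf := (M.f_pos x (Ioc_subset_Icc_self hx')).le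
      have h3 : 0 ≤ (M.J qf x - α) * (tent r z₁ x * (m - x)) := by
        rcases lt_or_ge |x - z₁| r with h4 | h4
        · have h5 := h1 ⟨by rw [Metric.mem_ball, Real.dist_eq]; linarith, hx'⟩
          simp only [mem_ofPred_eq] at h5
          exact mul_nonneg (by linarith)
            (mul_nonneg (tent_nonneg _ _ _) (by linarith [(abs_lt.1 h4).2]))
        · rw [tent_eq_zero h4]; simp
      have h3' : 0 ≤ (M.J qf x - α) * (tent r z₂ x * (m - x)) := by
        rcases lt_or_ge |x - z₂| r with h4 | h4
        · have h5 := h2 ⟨by rw [Metric.mem_ball, Real.dist_eq]; linarith, hx'⟩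
          simp only [mem_ofPred_eq] at h5
          exact mul_nonneg_of_nonpos_of_nonpos (by linarith)
            (mul_nonpos_of_nonneg_of_nonpos (tent_nonneg _ _ _) (by linarith [(abs_lt.1 h4).1]))
        · rw [tent_eq_zero h4]; simp
      have h6 : (M.J qf x - α) * (φ x * (m - x) * M.f x) =
          (A₂ * ((M.J qf x - α) * (tent r z₁ x * (m - x))) +
            A₁ * ((M.J qf x - α) * (tent r z₂ x * (m - x)))) * M.f x := by
        simp only [φ]; ring
      rw [h6]
      exact mul_nonneg (add_nonneg (mul_nonneg hA₂0.le h3) (mul_nonneg hA₁0.le h3')) hf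
    · refine mul_pos (sub_pos.2 hα₁) (mul_pos (mul_pos ?_ (by linarith)) (M.f_pos _ hz₁I))
      have : φ z₁ = A₂ * r + A₁ * tent r z₂ z₁ := by simp only [φ, tent_self hr0.le]
      rw [this]
      exact add_pos_of_pos_of_nonneg (mul_pos hA₂0 hr0) (mul_nonneg hA₁0.le (tent_nonneg _ _ _))
  -- The wage change falls by (φ x − φ y)(m − y) + φ x (y − x): the Lipschitz constant of `φ` times
  -- b − a bounds the first term, and the maximum of `φ` bounds the second.
  refine ⟨φ, m, z₁ - r, (A₂ + A₁) * (M.b - M.a) + (A₂ + A₁) * r, hφc, hφ0, fun x => ?_, hmI, hsI,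
    hφs, hbal, ?_, fun x hx y hy hxy => ?_⟩
  · have := mul_pos (add_pos hA₂0 hA₁0) (sub_pos.2 M.a_lt_b)
    linarith [hφr x]
  · have hi := hdi.mono_Icc hsI.1.le hsI.2.le le_rfl
    have : ∫ x in (z₁ - r)..M.b, (M.J qf x - α) * (φ x * (m - x) * M.f x) =
        (∫ x in (z₁ - r)..M.b, M.J qf x * (φ x * (m - x) * M.f x)) -
          α * ∫ x in (z₁ - r)..M.b, φ x * (m - x) * M.f x := by
      rw [← intervalIntegral.integral_const_mul, ← intervalIntegral.integral_sub
        (hi.continuousOn_mul (by rw [hus]; exact hJs)) (hi.const_mul _)]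
      exact intervalIntegral.integral_congr fun x _ => by ring
    rw [hbal', mul_zero, sub_zero] at this
    rwa [this] at hpos
  · have h3 := hφL x y
    rw [abs_of_pos (sub_pos.2 hxy)] at h3
    have h4 : |m - y| ≤ M.b - M.a :=
      abs_le.2 ⟨by linarith [hmI.1, hy.2], by linarith [hmI.2, hy.1]⟩
    have h5 : |(φ y - φ x) * (m - y)| ≤ (A₂ + A₁) * (y - x) * (M.b - M.a) := by
      rw [abs_mul]
      exact mul_le_mul h3 h4 (abs_nonneg _) ((abs_nonneg _).trans h3)
    have h6 : φ x * (y - x) ≤ (A₂ + A₁) * r * (y - x) :=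
      mul_le_mul_of_nonneg_right (hφr x) (sub_pos.2 hxy).le
    have h7 := (abs_le.1 h5).1
    linarith

theorem IsFullSeparationQuality.cost_eq_schemeCost (h : M.IsFullSeparationQuality w0 qf) {θ : ℝ}
    (hθ : θ ∈ Icc M.a M.b) : M.c (qf θ) = M.schemeCost w0 (fun θ => θ) θ := by
  rw [h.cost_eq hθ]
  unfold schemeCost
  rw [integral_id]
  ring

/-- Unless `J` increases, pooling a few types beats full separation. -/
theorem IsFullSeparationQuality.exists_improvement (h : M.IsFullSeparationQuality w0 qf)
    (hw0 : w0 ∈ Icc 0 M.a) (hJ : ¬ MonotoneOn (M.J qf) (Ioc M.a M.b)) :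
    ∃ q w : ℝ → ℝ, M.payoff qf < M.payoff q ∧ M.Admissible w0 q w ∧
      (w0 = M.a → ∃ (S : Type) (_ : MeasurableSpace S) (π : Kernel ℝ S) (ω : S → ℝ),
        IsMarkovKernel π ∧ M.IsEquilibrium π ω q) := by
  obtain ⟨φ, m, s, Λ, hφc, hφ0, hφΛ, hm, hs, hφs, hbal, hpos, hLip⟩ := h.exists_pooling hJ
  have hab := M.a_lt_b
  have haI : M.a ∈ Icc M.a M.b := left_mem_Icc.2 hab.le
  have hbI : M.b ∈ Icc M.a M.b := right_mem_Icc.2 hab.le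
  set D : ℝ → ℝ := fun x => φ x * (m - x) with hD
  have hDc : Continuous D := by fun_prop
  let W : ℝ → ℝ → ℝ := fun ε θ => θ + ε * φ θ * (m - θ)
  have hcost : ∀ ε, ∀ θ ∈ Icc M.a M.b, M.schemeCost w0 (W ε) θ =
      M.c (qf θ) + ε * (θ * D θ - ∫ x in M.a..θ, D x) := fun ε θ hθ => by
    rw [h.cost_eq_schemeCost hθ]
    have : ∫ x in M.a..θ, W ε x = (∫ x in M.a..θ, x) + ε * ∫ x in M.a..θ, D x := by
      rw [← intervalIntegral.integral_const_mul, ← intervalIntegral.integral_add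
        (f := fun x => x) (continuous_id.intervalIntegrable _ _) ((hDc.const_mul ε).intervalIntegrable _ _)]
      exact intervalIntegral.integral_congr fun x _ => by simp only [W, hD]; ring
    unfold schemeCost
    rw [this]
    simp only [W, hD]
    ring
  have hsmall : ∀ K x : ℝ, x < K → ∀ N : ℝ, ∀ᶠ ε in 𝓝[>] (0 : ℝ), x + ε * N < K := by
    intro K x hK N
    have : Tendsto (fun ε : ℝ => x + ε * N) (𝓝 0) (𝓝 (x + 0 * N)) :=
      (by fun_prop : Continuous fun ε : ℝ => x + ε * N).tendsto 0
    rw [zero_mul, add_zero] at this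
    exact (this.mono_left nhdsWithin_le_nhds).eventually_lt_const hK
  have hΛ : ∀ᶠ ε in 𝓝[>] (0 : ℝ), ε * Λ < 1 :=
    (hsmall 1 0 one_pos Λ).mono fun ε hε => by linarith
  have hWm : ∀ᶠ ε in 𝓝[>] (0 : ℝ), StrictMonoOn (W ε) (Icc M.a M.b) := by
    filter_upwards [hΛ, self_mem_nhdsWithin] with ε h1 hε x hx y hy hxy
    have hε : 0 < ε := hε
    have h2 := mul_le_mul_of_nonneg_left (hLip x hx y hy hxy) hε.le
    have h3 : ε * Λ * (y - x) < 1 * (y - x) := mul_lt_mul_of_pos_right h1 (sub_pos.2 hxy)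
    simp only [W]
    linarith
  have hWa : ∀ ε, W ε M.a = M.a := fun ε => by simp [W, hφs M.a hs.1.le]
  have hCa : ∀ ε, 0 ≤ M.schemeCost w0 (W ε) M.a := fun ε => by
    have : M.schemeCost w0 (W ε) M.a = M.a * (M.a - w0) := by
      simp only [schemeCost, hWa, intervalIntegral.integral_same]; ring
    rw [this]
    exact mul_nonneg M.a_nonneg (sub_nonneg.2 hw0.2)
  have hCb : ∀ᶠ ε in 𝓝[>] (0 : ℝ), M.schemeCost w0 (W ε) M.b ≤ M.c M.qmax := by
    -- Since qf(b) < `qmax` strictly, slightly larger costs remain feasible for the top type.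
    have hlt : M.c (qf M.b) < M.c M.qmax :=
      M.c_strictMonoOn (h.mem_Icc hbI) ⟨M.qmax_pos.le, le_rfl⟩ (h.mem M.b hbI).2
    filter_upwards [hsmall _ _ hlt (M.b * D M.b - ∫ x in M.a..M.b, D x)] with ε hε
    rw [hcost ε M.b hbI]
    exact hε.le
  have hex : ∀ᶠ ε in 𝓝[>] (0 : ℝ), ∃ q : ℝ → ℝ, (∀ θ ∈ Icc M.a M.b, q θ ∈ Icc 0 M.qmax) ∧
      ∀ θ ∈ Icc M.a M.b, M.c (q θ) = M.schemeCost w0 (W ε) θ := by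
    filter_upwards [hWm, hCb] with ε h1 h2
    exact exists_quality_of_schemeCost h1 (hCa ε) h2
  choose! q hq using fun ε (hε : ∃ q : ℝ → ℝ, (∀ θ ∈ Icc M.a M.b, q θ ∈ Icc 0 M.qmax) ∧
    ∀ θ ∈ Icc M.a M.b, M.c (q θ) = M.schemeCost w0 (W ε) θ) => hε
  have hgain := h.eventually_payoff_lt hs hDc (fun x hx => by simp [hD, hφs x hx]) hpos
    (q := q) (hex.mono fun ε hε => (hq ε hε).1)
    (by filter_upwards [hex, hWm] with ε hε h1 using
      (strictMonoOn_of_schemeCost (hq ε hε).1 (hq ε hε).2 h1).monotoneOn)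
    (hex.mono fun ε hε θ hθ => by rw [(hq ε hε).2 θ hθ, hcost ε θ hθ])
  obtain ⟨ε, hg, hε, hm1, hΛ1, hε0⟩ := (hgain.and (hex.and (hWm.and (hΛ.and
    self_mem_nhdsWithin)))).exists
  have hε0 : 0 < ε := hε0
  obtain ⟨hqQ, hqc⟩ := hq ε hε
  have hDf : IntervalIntegrable (fun x => D x * M.f x) volume M.a M.b :=
    M.f_mul_intervalIntegrable (hDc.intervalIntegrable _ _)
  have hxf : IntervalIntegrable (fun x => x * M.f x) volume M.a M.b :=
    M.f_mul_intervalIntegrable (w := fun x => x) (continuous_id.intervalIntegrable _ _)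
  have hWf : ∀ t ∈ Icc M.a M.b, ∫ x in M.a..t, W ε x * M.f x =
      (∫ x in M.a..t, x * M.f x) + ε * ∫ x in M.a..t, D x * M.f x := fun t ht => by
    rw [← intervalIntegral.integral_const_mul, ← intervalIntegral.integral_add
      (hxf.mono_Icc le_rfl ht.1 ht.2) ((hDf.mono_Icc le_rfl ht.1 ht.2).const_mul _)]
    exact intervalIntegral.integral_congr fun x _ => by simp only [W, hD]; ring
  -- `D` is nonnegative below m and nonpositive above, and D f integrates to zero, so its partial
  -- integrals are nonnegative; this is (MPS).
  have hK : ∀ t ∈ Icc M.a M.b, 0 ≤ ∫ x in M.a..t, D x * M.f x := fun t ht => by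
    rcases le_total t m with htm | htm
    · refine intervalIntegral.integral_nonneg ht.1 fun x hx => ?_
      exact mul_nonneg (mul_nonneg (hφ0 x) (by linarith [hx.2]))
        (M.f_pos x ⟨hx.1, hx.2.trans ht.2⟩).le
    · have h1 : ∫ x in t..M.b, D x * M.f x ≤ 0 := by
        rw [← neg_nonneg, ← intervalIntegral.integral_neg]
        refine intervalIntegral.integral_nonneg ht.2 fun x hx => ?_
        have h2 : 0 ≤ φ x * (x - m) * M.f x :=
          mul_nonneg (mul_nonneg (hφ0 x) (by linarith [hx.1]))
            (M.f_pos x ⟨ht.1.trans hx.1, hx.2⟩).le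
        simp only [hD]
        linarith
      have h3 := intervalIntegral.integral_add_adjacent_intervals
        (hDf.mono_Icc le_rfl ht.1 ht.2) (hDf.mono_Icc ht.1 ht.2 le_rfl)
      rw [hbal] at h3
      linarith
  refine ⟨q ε, W ε, hg, admissible_of_schemeCost hqQ hqc hw0 hm1 (hWa ε) (fun t ht => ?_) ?_,
    fun hwa => ?_⟩
  · rw [hWf t ht]
    linarith [mul_nonneg hε0.le (hK t ht)]
  · rw [hWf M.b hbI, hbal, mul_zero, add_zero]
  · subst hwa
    have hbal' : ∫ x in M.a..M.b, ε * φ x * (m - x) * M.f x = 0 := by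
      have : ∫ x in M.a..M.b, ε * φ x * (m - x) * M.f x = ε * ∫ x in M.a..M.b, D x * M.f x := by
        rw [← intervalIntegral.integral_const_mul]
        exact intervalIntegral.integral_congr fun x _ => by simp only [hD]; ring
      rw [this, hbal, mul_zero]
    obtain ⟨S, hS, π, ω, h1, h2, _⟩ := exists_rating_of_pooling (p := fun x => ε * φ x)
      (hφc.const_mul ε) (fun x => ⟨mul_nonneg hε0.le (hφ0 x),
        (mul_le_mul_of_nonneg_left (hφΛ x) hε0.le).trans hΛ1.le⟩)
      (by simp [hφs M.a hs.1.le]) hm hbal' hm1 hqQ hqc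
    exact ⟨S, hS, π, ω, h1, h2⟩

theorem IsFullSeparationQuality.admissible (h : M.IsFullSeparationQuality w0 qf)
    (hw0 : w0 ∈ Icc 0 M.a) : M.Admissible w0 qf (fun θ => θ) :=
  admissible_of_schemeCost (fun _ => h.mem_Icc) (fun _ => h.cost_eq_schemeCost) hw0
    (strictMono_id.strictMonoOn _) rfl (fun _ _ => le_rfl) rfl

theorem IsFullSeparationQuality.exists_rating (h : M.IsFullSeparationQuality M.a qf) :
    ∃ (S : Type) (_ : MeasurableSpace S) (π : Kernel ℝ S) (ω : S → ℝ),
      IsMarkovKernel π ∧ M.IsEquilibrium π ω qf ∧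
        ∀ θ ∈ Icc M.a M.b, interimWage π ω (qf θ) = θ := by
  -- Full separation is the case of no pooling; the pooled score a then never matters.
  have := exists_rating_of_pooling (p := fun _ => 0) (m := M.a) (q := qf) continuous_const
    (fun _ => ⟨le_rfl, zero_le_one⟩) rfl (left_mem_Icc.2 M.a_lt_b.le) (by simp)
    (fun x _ y _ hxy => by simpa using hxy) (fun _ => h.mem_Icc)
    (fun θ hθ => by simpa using h.cost_eq_schemeCost hθ)
  simpa using this

/-! ### The two equivalences. -/

theorem isOptimalMechanism_iff (h : M.IsFullSeparationQuality w0 qf) (hw0 : w0 ∈ Icc 0 M.a)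
    (hb : ∀ θ ∈ Icc M.a M.b, 0 ≤ M.vq (qf θ) θ) :
    M.IsOptimalMechanism w0 qf (fun θ => θ) ↔ MonotoneOn (M.J qf) (Ioc M.a M.b) := by
  refine ⟨fun hopt => ?_, fun hJ => ⟨h.admissible hw0, fun q w hA => hA.payoff_le hw0 h hb hJ⟩⟩
  by_contra hJ
  obtain ⟨q, w, hlt, hA, _⟩ := h.exists_improvement hw0 hJ
  exact absurd (hopt.2 q w hA) (not_le.2 hlt)

theorem isOptimalUnderRatings_iff (h : M.IsFullSeparationQuality M.a qf)
    (hb : ∀ θ ∈ Icc M.a M.b, 0 ≤ M.vq (qf θ) θ) :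
    M.IsOptimalUnderRatings qf (fun θ => θ) ↔ MonotoneOn (M.J qf) (Ioc M.a M.b) := by
  have hw0 : M.a ∈ Icc 0 M.a := ⟨M.a_nonneg, le_rfl⟩
  refine ⟨fun hopt => ?_, fun hJ => ⟨h.exists_rating, fun S _ π ω q hπ hE =>
    hE.admissible.payoff_le hw0 h hb hJ⟩⟩
  by_contra hJ
  obtain ⟨q, w, hlt, _, hr⟩ := h.exists_improvement hw0 hJ
  obtain ⟨S, hS, π, ω, hπ, hE⟩ := hr rfl
  exact absurd (hopt.2 S hS π ω q hπ hE) (not_le.2 hlt)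

/-! ### The linear case -/

theorem integral_f_eq {θ : ℝ} (hθ : θ ∈ Icc M.a M.b) : ∫ x in θ..M.b, M.f x = 1 - M.F θ := by
  have hi : IntervalIntegrable M.f volume M.a M.b :=
    ContinuousOn.intervalIntegrable (by rw [uIcc_of_le M.a_lt_b.le]; exact M.f_cont)
  have := intervalIntegral.integral_add_adjacent_intervals (hi.mono_Icc le_rfl hθ.1 hθ.2)
    (hi.mono_Icc hθ.1 hθ.2 le_rfl)
  rw [M.f_prob] at this
  unfold F
  linarith

theorem J_eqOn_virtualValue (h : M.IsFullSeparationQuality w0 qf)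
    (hlin : ∀ q ∈ Icc 0 M.qmax, M.c q = q ∧ ∀ θ ∈ Icc M.a M.b, M.v q θ = q) :
    EqOn (M.J qf) M.virtualValue (Icc M.a M.b) := by
  have hc : ∀ q ∈ Icc 0 M.qmax, M.c' q = 1 := fun q hq => by
    unfold c'
    rw [derivWithin_congr (f := fun x => x) (fun x hx => (hlin x hx).1) (hlin q hq).1]
    exact derivWithin_id _ _ (uniqueDiffOn_Icc M.qmax_pos q hq)
  have hv : ∀ q ∈ Icc 0 M.qmax, ∀ θ ∈ Icc M.a M.b, M.vq q θ = 1 := fun q hq θ hθ => by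
    unfold vq
    rw [derivWithin_congr (f := fun x => x) (fun x hx => (hlin x hx).2 θ hθ) ((hlin q hq).2 θ hθ)]
    exact derivWithin_id _ _ (uniqueDiffOn_Icc M.qmax_pos q hq)
  intro θ hθ
  unfold J virtualValue
  rw [hc _ (h.mem_Icc hθ), hv _ (h.mem_Icc hθ) θ hθ, ← integral_f_eq hθ]
  have : ∫ x in θ..M.b, M.vq (qf x) x / M.c' (qf x) * M.f x = ∫ x in θ..M.b, M.f x := by
    refine intervalIntegral.integral_congr fun x hx => ?_
    rw [uIcc_of_le hθ.2] at hx
    have hx' : x ∈ Icc M.a M.b := ⟨hθ.1.trans hx.1, hx.2⟩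
    rw [hc _ (h.mem_Icc hx'), hv _ (h.mem_Icc hx') x hx']
    ring
  rw [this]
  ring

theorem virtualValue_continuousOn : ContinuousOn M.virtualValue (Icc M.a M.b) := by
  have := intervalIntegral.continuousOn_primitive_interval (a := M.a) (b := M.b) (μ := volume)
    (f := M.f) (by rw [uIcc_of_le M.a_lt_b.le]; exact M.f_cont.integrableOn_Icc)
  rw [uIcc_of_le M.a_lt_b.le] at this
  exact continuousOn_id.sub ((continuousOn_const.sub this).div M.f_cont
    fun θ hθ => (M.f_pos θ hθ).ne')

/-- Applied to the virtual value, which is continuous at a; this closes the interval on the left in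
the linear case. -/
theorem monotoneOn_Icc_of_monotoneOn_Ioc {g : ℝ → ℝ} {a b : ℝ} (hc : ContinuousOn g (Icc a b))
    (hm : MonotoneOn g (Ioc a b)) : MonotoneOn g (Icc a b) := by
  intro x hx y hy hxy
  rcases hx.1.eq_or_lt with rfl | hax
  · rcases hxy.eq_or_lt with rfl | hxy
    · exact le_rfl
    have hne : (𝓝[Ioo a y] a).NeBot := by
      rw [nhdsWithin_Ioo_eq_nhdsGT hxy]; infer_instance
    have hlim : Tendsto g (𝓝[Ioo a y] a) (𝓝 (g a)) :=
      (hc a hx).mono fun z hz => ⟨hz.1.le, hz.2.le.trans hy.2⟩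
    refine le_of_tendsto hlim ?_
    filter_upwards [self_mem_nhdsWithin] with z hz
    exact hm ⟨hz.1, hz.2.le.trans hy.2⟩ ⟨hxy, hy.2⟩ hz.2.le
  · exact hm ⟨hax, hx.2⟩ ⟨hax.trans_le hxy, hy.2⟩ hxy

theorem monotoneOn_J_iff (h : M.IsFullSeparationQuality w0 qf)
    (hlin : ∀ q ∈ Icc 0 M.qmax, M.c q = q ∧ ∀ θ ∈ Icc M.a M.b, M.v q θ = q) :
    MonotoneOn (M.J qf) (Ioc M.a M.b) ↔ MonotoneOn M.virtualValue (Icc M.a M.b) := by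
  have heq := (J_eqOn_virtualValue h hlin).mono Ioc_subset_Icc_self
  exact ⟨fun hm => monotoneOn_Icc_of_monotoneOn_Ioc virtualValue_continuousOn (hm.congr heq),
    fun hm => (hm.mono Ioc_subset_Icc_self).congr heq.symm⟩

end SignalingModel

end

theorem mainTheorem11 (M : SignalingModel) (w0 : ℝ) (hw0 : w0 ∈ Set.Icc 0 M.a)
    (qf : ℝ → ℝ) (hqf : M.IsFullSeparationQuality w0 qf)
    (downward_bias : ∀ θ ∈ Set.Icc M.a M.b, 0 ≤ M.vq (qf θ) θ) :
    (M.IsOptimalMechanism w0 qf (fun θ => θ) ↔ MonotoneOn (M.J qf) (Set.Ioc M.a M.b)) ∧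
    (w0 = M.a →
      (M.IsOptimalUnderRatings qf (fun θ => θ) ↔ MonotoneOn (M.J qf) (Set.Ioc M.a M.b))) ∧
    ((∀ q ∈ Set.Icc 0 M.qmax, M.c q = q ∧ ∀ θ ∈ Set.Icc M.a M.b, M.v q θ = q) →
      Set.EqOn (M.J qf) M.virtualValue (Set.Icc M.a M.b) ∧
      (M.IsOptimalMechanism w0 qf (fun θ => θ) ↔
        MonotoneOn M.virtualValue (Set.Icc M.a M.b)) ∧
      (w0 = M.a →
        (M.IsOptimalUnderRatings qf (fun θ => θ) ↔
          MonotoneOn M.virtualValue (Set.Icc M.a M.b)))) := by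
  have h1 := SignalingModel.isOptimalMechanism_iff hqf hw0 downward_bias
  have h2 : w0 = M.a →
      (M.IsOptimalUnderRatings qf (fun θ => θ) ↔ MonotoneOn (M.J qf) (Set.Ioc M.a M.b)) := by
    rintro rfl
    exact SignalingModel.isOptimalUnderRatings_iff hqf downward_bias
  refine ⟨h1, h2, fun hlin => ⟨SignalingModel.J_eqOn_virtualValue hqf hlin, ?_, fun hwa => ?_⟩⟩
  · rw [h1, SignalingModel.monotoneOn_J_iff hqf hlin]
  · rw [h2 hwa, SignalingModel.monotoneOn_J_iff hqf hlin]
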